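/- **Setting.** A hybrid inclusion $\mathcal H=(C,F,D,G)$ on $\mathbb R^n$ consists of sets $C,D\subset\mathbb R^n$ and set-valued maps $F,G:\mathbb R^n\rightrightarrows\mathbb R^n$. It satisfies the *hybrid basic conditions* if $C,D$ are closed, $F,G$ are outer semicontinuous and locally bounded, $F(x)$ is nonempty and convex for $x\in C$, and $G(x)$ is nonempty for $x\in D$. A *solution* is a hybrid arc $\psi$ (a function on a hybrid time domain $\operatorname{dom}\psi\subset\mathbb R_{\ge0}\times\mathbb Z_{\ge0}$, locally absolutely continuous in $t$ for each $j$) with $\psi(0,0)\in C\cup D$ such that, on each $[t_1,t_2]\times\{j\}\subset\operatorname{dom}\psi$ with $t_1<t_2$, $\psi(t,j)\in C$ and $\dot\psi(t,j)\in F(\psi(t,j))$ for almost all $t$, and such that $(t,j),(t,j+1)\in\operatorname{dom}\psi$ implies $\psi(t,j)\in D$ and $\psi(t,j+1)\in G(\psi(t,j))$. It is *complete* if $\operatorname{dom}\psi$ is unbounded. A compact set $K$ is *weakly invariant* for $\mathcal H$ if for all $x\in K$ and $T>0$ there are a complete solution $\psi$ with all its values in $K$ and $(s,i)\in\operatorname{dom}\psi$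 with $s+i\ge T$ and $\psi(s,i)=x$. A set $K$ is *internally chain transitive* for $\mathcal H$ if for all $x,y\in K$ and $\tau,\varepsilon>0$ there are $k^*\ge1$, points $x=x_0,\dots,x_{k^*}=y$, solutions $\psi_0,\dots,\psi_{k^*-1}$ and $(t_k,j_k)\in\operatorname{dom}\psi_k$ with $t_k+j_k\ge\tau$ such that, for $0\le k<k^*$, $\psi_k(0,0)=x_k$, $|x_{k+1}-\psi_k(t_k,j_k)|\le\varepsilon$, and $\psi_k(t,j)\in K$ for all $(t,j)\in\operatorname{dom}\psi_k$ with $t+j\le t_k+j_k$. A *hybrid sequence* is a function $\phi$ on a hybrid sequence domain, i.e. the union of a nondecreasing sequence of sets of the form $\bigcup_{j=0}^{J-1}\{k_j,\dots,k_{j+1}\}\times\{j\}$ with $J\ge 1$ and integers $0=k_0\le\dots\le k_J$. It is *complete* if its domain is unbounded, and complete in the $k$- (or $j$-) direction if the set of $k$'s (or $j$'s) in its domain is unbounded. Put $\overline\jmath_k=\inf\{j:(k+1,j)\in\operatorname{dom}\phi\}$ and $\overline k_j=\inf\{k:(k,j+1)\in\operatorname{dom}\phi\}$. Its $\omega$-limit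 set is $\omega(\phi)=\bigcap_{i}\overline{\{\phi(k,j):(k,j)\in\operatorname{dom}\phi,\ k+j\ge i\}}$. Step sizes $\{h_k\}_{k\ge1}$ are *admissible* if $h_k>0$, $h_k\to0$ and $\sum_k h_k=\infty$; put $\tau_k=\sum_{i=1}^{k}h_i$ and $m(t)=\max\{k:\tau_k\le t\}$. A pair $H_k=(h_{s,k},h_{f,k})$ is *two-timescale admissible* if both sequences are admissible and $h_{s,k}/h_{f,k}\to0$; write $\tau_{r,k}$, $m_r$ for the quantities associated with $h_r$, $r\in\{s,f\}$. Let $C,D\subset\mathbb R^{n_s}\times\mathbb R^{n_f}$, let $F_s,F_f$ be set-valued maps from $\mathbb R^{n_s}\times\mathbb R^{n_f}$ to $\mathbb R^{n_s}$ and $\mathbb R^{n_f}$, let $G$ be a set-valued map from $\mathbb R^{n_s}\times\mathbb R^{n_f}$ to itself, and let $\mathcal H^1_{\mathrm{TT}}=(C,F^1,D,G)$ with $F^1(x)=F_s(x)\times F_f(x)$. A pair $(\Phi,\{H_k\})$, $\Phi=(\phi_s,\phi_f)$, is a *two-timescale asymptotic simulation* of $\mathcal H^1_{\mathrm{TT}}$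 if $\Phi$ is a bounded complete hybrid sequence, $\{H_k\}$ is two-timescale admissible, and: 1. if $\Phi$ is complete in the $k$-direction, there is a bounded sequence $f_k=(f_{s,k},f_{f,k})$, $k\ge 0$, such that every accumulation point $(x,v)$ of $(\Phi(k,\overline\jmath_k),f_k)$ satisfies $x\in C$, $v\in F^1(x)$, and for $r\in\{s,f\}$ and every $T>0$ $$\lim_{n\to\infty}\ \sup_{n+1\le k\le m_r(\tau_{r,n}+T)}\Bigl|\sum_{i=n}^{k-1}h_{r,i+1}\Bigl(\tfrac{\phi_r(i+1,\overline\jmath_i)-\phi_r(i,\overline\jmath_i)}{h_{r,i+1}}-f_{r,i}\Bigr)\Bigr|=0;$$ 2. if $\Phi$ is complete in the $j$-direction, every accumulation point $(x,g)$ of $(\Phi(\overline k_j,j),\Phi(\overline k_j,j+1))$ satisfies $x\in D$, $g\in G(x)$. For $\Lambda:\mathbb R^{n_s}\rightrightarrows\mathbb R^{n_f}$ put $\Lambda^C(x_s)=\{x_f\in\Lambda(x_s):(x_s,x_f)\in C\}$ and $\Lambda^D(x_s)=\{x_f\in\Lambda(x_s):(x_s,x_f)\in D\}$. The *reduced system*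 is $\mathcal H_{\mathrm R}^\Lambda=(C_{\mathrm R},F_{\mathrm R},D_{\mathrm R},G_{\mathrm R})$ on $\mathbb R^{n_s}$, where $C_{\mathrm R}=\{x_s:\Lambda^C(x_s)\ne\emptyset\}$, $D_{\mathrm R}=\{x_s:\Lambda^D(x_s)\ne\emptyset\}$, $F_{\mathrm R}(x_s)=\overline{\mathrm{co}}\bigcup_{x_f\in\Lambda^C(x_s)}F_s(x_s,x_f)$, and $G_{\mathrm R}(x_s)=\bigcup_{x_f\in\Lambda^D(x_s)}\mathrm{proj}_s\,G(x_s,x_f)$. **Statement.** Let $\mathcal H^1_{\mathrm{TT}}$ satisfy the hybrid basic conditions, let $(\Phi,\{H_k\})$ be a two-timescale asymptotic simulation of $\mathcal H^1_{\mathrm{TT}}$, and let $\Lambda:\mathbb R^{n_s}\rightrightarrows\mathbb R^{n_f}$ have compact graph with $\omega(\Phi)\subset\operatorname{graph}(\Lambda)$. Then there are compact sets $\mathcal K\subset\mathbb R^{n_s}$ that contain every compact set which is both weakly invariant and internally chain transitive for $\mathcal H_{\mathrm R}^\Lambda$, and for every such $\mathcal K$ $$\omega(\Phi)\subset\operatorname{graph}(\Lambda)\cap(\mathcal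 K\times\mathbb R^{n_f}).$$ Moreover, $\omega(\phi_s)$ is nonempty, compact, internally chain transitive for $\mathcal H_{\mathrm R}^\Lambda$, and weakly invariant for $\mathcal H_{\mathrm R}^\Lambda$. -/

import Mathlib

open Set Filter Topology

noncomputable section

namespace HybridInclusion

/-! ### Set-valued mappings -/

/-- Graph of a set-valued mapping. -/
def graph {X Y : Type*} (S : X → Set Y) : Set (X × Y) := {p | p.2 ∈ S p.1}

/-- Domain of a set-valued mapping. -/
def domain {X Y : Type*} (S : X → Set Y) : Set X := {x | (S x).Nonempty}

/-- Restriction of a set-valued mapping to a set: its value is empty off that set. -/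
def restrictTo {X Y : Type*} (S : X → Set Y) (A : Set X) : X → Set Y :=
  fun x => {y | x ∈ A ∧ y ∈ S x}

/-- Outer semicontinuity, sequentially. -/
def OuterSemicontinuous {X Y : Type*} [TopologicalSpace X] [TopologicalSpace Y]
    (S : X → Set Y) : Prop :=
  ∀ (x : X) (y : Y) (u : ℕ → X) (v : ℕ → Y), Tendsto u atTop (𝓝 x) → Tendsto v atTop (𝓝 y) →
    (∀ i, v i ∈ S (u i)) → y ∈ S x

/-- Local boundedness: every point has a neighborhood with bounded image. -/
def IsLocallyBounded {X Y : Type*} [TopologicalSpace X] [Bornology Y] (S : X → Set Y) : Prop :=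
  ∀ x : X, ∃ U ∈ 𝓝 x, Bornology.IsBounded (⋃ u ∈ U, S u)

/-- Outer limit of a sequence of points: the set of its accumulation points. -/
def outerLimit {X : Type*} [TopologicalSpace X] (u : ℕ → X) : Set X :=
  {z | MapClusterPt z atTop u}

/-! ### Hybrid inclusions and their solutions -/

/-- The data `(C, F, D, G)` of a hybrid inclusion. -/
structure HybridSystem (E : Type*) where
  C : Set E
  F : E → Set E
  D : Set E
  G : E → Set E

/-- The hybrid basic conditions. -/
structure HybridSystem.BasicConditions {E : Type*} [NormedAddCommGroup E] [NormedSpace ℝ E]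
    (H : HybridSystem E) : Prop where
  isClosed_C : IsClosed H.C
  isClosed_D : IsClosed H.D
  osc_F : OuterSemicontinuous H.F
  locallyBounded_F : IsLocallyBounded H.F
  osc_G : OuterSemicontinuous H.G
  locallyBounded_G : IsLocallyBounded H.G
  nonempty_F : ∀ x ∈ H.C, (H.F x).Nonempty
  convex_F : ∀ x ∈ H.C, Convex ℝ (H.F x)
  nonempty_G : ∀ x ∈ H.D, (H.G x).Nonempty

/-- Compact hybrid time domains `⋃_{j<J} [t_j, t_{j+1}] × {j}` with `0 = t_0 ≤ ⋯ ≤ t_J`. -/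
def IsCompactHybridTimeDomain (E : Set (ℝ × ℕ)) : Prop :=
  ∃ (J : ℕ) (t : ℕ → ℝ), 0 < J ∧ t 0 = 0 ∧ (∀ j < J, t j ≤ t (j + 1)) ∧
    E = {p | p.2 < J ∧ t p.2 ≤ p.1 ∧ p.1 ≤ t (p.2 + 1)}

/-- (Nonempty) hybrid time domains: all truncations are compact hybrid time domains. -/
def IsHybridTimeDomain (E : Set (ℝ × ℕ)) : Prop :=
  E.Nonempty ∧ ∀ p ∈ E, IsCompactHybridTimeDomain (E ∩ (Icc 0 p.1 ×ˢ Iic p.2))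

/-- A hybrid arc: a function on a hybrid time domain that is locally absolutely continuous in `t`
for each `j`. The values of `toFun` off `dom` are irrelevant. -/
structure HybridArc (E : Type*) [NormedAddCommGroup E] where
  dom : Set (ℝ × ℕ)
  toFun : ℝ → ℕ → E
  isHybridTimeDomain : IsHybridTimeDomain dom
  absolutelyContinuous : ∀ (j : ℕ) (t₁ t₂ : ℝ), t₁ < t₂ → Icc t₁ t₂ ×ˢ {j} ⊆ dom →
    AbsolutelyContinuousOnInterval (fun t => toFun t j) t₁ t₂

/-- A hybrid arc is complete if its domain is unbounded. -/
def HybridArc.IsComplete {E : Type*} [NormedAddCommGroup E] (ψ : HybridArc E) : Prop :=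
  ∀ T : ℝ, ∃ p ∈ ψ.dom, T ≤ p.1 + p.2

/-- `ψ` is a solution of the hybrid inclusion `H`. -/
structure HybridSystem.IsSolution {E : Type*} [NormedAddCommGroup E] [NormedSpace ℝ E]
    (H : HybridSystem E) (ψ : HybridArc E) : Prop where
  initial : ψ.toFun 0 0 ∈ H.C ∪ H.D
  flow : ∀ (j : ℕ) (t₁ t₂ : ℝ), t₁ < t₂ → Icc t₁ t₂ ×ˢ {j} ⊆ ψ.dom →
    ∀ᵐ t ∂(MeasureTheory.volume.restrict (Icc t₁ t₂)), ψ.toFun t j ∈ H.C ∧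
      ∃ v ∈ H.F (ψ.toFun t j), HasDerivWithinAt (fun s => ψ.toFun s j) v (Icc t₁ t₂) t
  jump : ∀ (t : ℝ) (j : ℕ), (t, j) ∈ ψ.dom → (t, j + 1) ∈ ψ.dom →
    ψ.toFun t j ∈ H.D ∧ ψ.toFun t (j + 1) ∈ H.G (ψ.toFun t j)

/-- Weak invariance (forward and backward) of a compact set. -/
def HybridSystem.WeaklyInvariant {E : Type*} [NormedAddCommGroup E] [NormedSpace ℝ E]
    (H : HybridSystem E) (K : Set E) : Prop :=
  IsCompact K ∧ ∀ x ∈ K, ∀ T : ℝ, 0 < T → ∃ ψ : HybridArc E, H.IsSolution ψ ∧ ψ.IsComplete ∧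
    (∀ p ∈ ψ.dom, ψ.toFun p.1 p.2 ∈ K) ∧
    ∃ q ∈ ψ.dom, T ≤ q.1 + q.2 ∧ ψ.toFun q.1 q.2 = x

/-- There is an internal `(τ, ε)`-chain in `K` from `a` to `b`, made of at least one solution. -/
def HybridSystem.HasInternalChain {E : Type*} [NormedAddCommGroup E] [NormedSpace ℝ E]
    (H : HybridSystem E) (K : Set E) (τ ε : ℝ) (a b : E) : Prop :=
  ∃ (n : ℕ) (x : ℕ → E) (ψ : ℕ → HybridArc E) (q : ℕ → ℝ × ℕ), 0 < n ∧ x 0 = a ∧ x n = b ∧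
    ∀ k < n, H.IsSolution (ψ k) ∧ (ψ k).toFun 0 0 = x k ∧
      q k ∈ (ψ k).dom ∧ τ ≤ (q k).1 + (q k).2 ∧
      x (k + 1) ∈ Metric.closedBall ((ψ k).toFun (q k).1 (q k).2) ε ∧
      ∀ p ∈ (ψ k).dom, p.1 + p.2 ≤ (q k).1 + (q k).2 → (ψ k).toFun p.1 p.2 ∈ K

/-- Internal chain transitivity. -/
def HybridSystem.InternallyChainTransitive {E : Type*} [NormedAddCommGroup E] [NormedSpace ℝ E]
    (H : HybridSystem E) (K : Set E) : Prop :=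
  ∀ a ∈ K, ∀ b ∈ K, ∀ τ ε : ℝ, 0 < τ → 0 < ε → H.HasInternalChain K τ ε a b

/-! ### Hybrid sequences -/

/-- Compact hybrid sequence domains `⋃_{j<J} {k_j, …, k_{j+1}} × {j}` with
`0 = k_0 ≤ ⋯ ≤ k_J`. -/
def IsCompactHybridSeqDomain (E : Set (ℕ × ℕ)) : Prop :=
  ∃ (J : ℕ) (κ : ℕ → ℕ), 0 < J ∧ κ 0 = 0 ∧ (∀ j < J, κ j ≤ κ (j + 1)) ∧
    E = {p | p.2 < J ∧ κ p.2 ≤ p.1 ∧ p.1 ≤ κ (p.2 + 1)}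

/-- Hybrid sequence domains: unions of nondecreasing sequences of compact ones. -/
def IsHybridSeqDomain (E : Set (ℕ × ℕ)) : Prop :=
  ∃ A : ℕ → Set (ℕ × ℕ), Monotone A ∧ (∀ i, IsCompactHybridSeqDomain (A i)) ∧ E = ⋃ i, A i

/-- A hybrid sequence. The values of `toFun` off `dom` are irrelevant. -/
structure HybridSeq (E : Type*) where
  dom : Set (ℕ × ℕ)
  toFun : ℕ → ℕ → E
  isHybridSeqDomain : IsHybridSeqDomain dom

namespace HybridSeq

variable {E E' : Type*}

/-- Composition of a hybrid sequence with a function on the state space. -/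
def map (g : E → E') (φ : HybridSeq E) : HybridSeq E' where
  dom := φ.dom
  toFun := fun k j => g (φ.toFun k j)
  isHybridSeqDomain := φ.isHybridSeqDomain

/-- The domain is unbounded. -/
def IsComplete (φ : HybridSeq E) : Prop := ∀ N : ℕ, ∃ p ∈ φ.dom, N ≤ p.1 + p.2

/-- Completeness in the `k`-direction. -/
def IsCompleteK (φ : HybridSeq E) : Prop := ∀ N : ℕ, ∃ p ∈ φ.dom, N ≤ p.1

/-- Completeness in the `j`-direction. -/
def IsCompleteJ (φ : HybridSeq E) : Prop := ∀ N : ℕ, ∃ p ∈ φ.dom, N ≤ p.2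

/-- Boundedness of the range. -/
def IsBounded [Bornology E] (φ : HybridSeq E) : Prop :=
  Bornology.IsBounded {z | ∃ p ∈ φ.dom, φ.toFun p.1 p.2 = z}

/-- `inf {j : (k+1, j) ∈ dom φ}`; used only for sequences complete in the `k`-direction, where the
set is nonempty. -/
def jBar (φ : HybridSeq E) (k : ℕ) : ℕ := sInf {j | (k + 1, j) ∈ φ.dom}

/-- `inf {k : (k, j+1) ∈ dom φ}`; used only for sequences complete in the `j`-direction, where the
set is nonempty. -/
def kBar (φ : HybridSeq E) (j : ℕ) : ℕ := sInf {k | (k, j + 1) ∈ φ.dom}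

/-- The `ω`-limit set: the limit of the nonincreasing sequence of tails, that is, the intersection
of their closures. -/
def omegaLimit [TopologicalSpace E] (φ : HybridSeq E) : Set E :=
  ⋂ i : ℕ, closure {z | ∃ p ∈ φ.dom, i ≤ p.1 + p.2 ∧ φ.toFun p.1 p.2 = z}

end HybridSeq

/-! ### Step sizes -/

/-- Admissible step sizes `h 1, h 2, …`; the value `h 0` is not used. -/
structure Admissible (h : ℕ → ℝ) : Prop where
  pos : ∀ k, 1 ≤ k → 0 < h k
  tendsto_zero : Tendsto h atTop (𝓝 0)
  not_summable : ¬ Summable (fun k => h (k + 1))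

/-- Two-timescale admissible step sizes (`hs` slow, `hf` fast). -/
structure TwoTimescaleAdmissible (hs hf : ℕ → ℝ) : Prop where
  slow : Admissible hs
  fast : Admissible hf
  ratio : Tendsto (fun k => hs k / hf k) atTop (𝓝 0)

/-- Accumulated time `τ_k`. -/
def accTime (h : ℕ → ℝ) (k : ℕ) : ℝ := ∑ i ∈ Finset.range k, h (i + 1)

/-- `m(t) = max {k : τ_k ≤ t}`. -/
def lastIndex (h : ℕ → ℝ) (t : ℝ) : ℕ := sSup {k | accTime h k ≤ t}

/-- The index set `{k : n + 1 ≤ k ≤ m(τ_n + T)}`. -/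
def indexSet (h : ℕ → ℝ) (n : ℕ) (T : ℝ) : Set ℕ := Icc (n + 1) (lastIndex h (accTime h n + T))

/-- The difference quotient `f̂_{k+1}` of a hybrid sequence along its flow step from `k` to
`k + 1`. -/
def HybridSeq.diffQuot {E : Type*} [NormedAddCommGroup E] [NormedSpace ℝ E]
    (φ : HybridSeq E) (h : ℕ → ℝ) (k : ℕ) : E :=
  (h (k + 1))⁻¹ • (φ.toFun (k + 1) (φ.jBar k) - φ.toFun k (φ.jBar k))

/-- For each `T > 0`, the accumulated errors between `f̂_{i+1}` and `f_i`, over windows of length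
`T` that start at step `n`, tend to `0` uniformly as `n → ∞`. -/
def FlowCloseness {E : Type*} [NormedAddCommGroup E] [NormedSpace ℝ E]
    (φ : HybridSeq E) (h : ℕ → ℝ) (f : ℕ → E) : Prop :=
  ∀ T : ℝ, 0 < T → Tendsto (fun n : ℕ => sSup ((fun k : ℕ =>
    ‖∑ i ∈ Finset.Ico n k, h (i + 1) • (φ.diffQuot h i - f i)‖) '' indexSet h n T)) atTop (𝓝 0)

/-! ### Two-timescale systems -/

/-- The data of a two-timescale hybrid inclusion with slow state in `X`, fast state in `Y`. -/
structure TwoTimescaleSystem (X Y : Type*) where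
  C : Set (X × Y)
  Fs : X × Y → Set X
  Ff : X × Y → Set Y
  D : Set (X × Y)
  G : X × Y → Set (X × Y)

namespace TwoTimescaleSystem

variable {X Y : Type*}

/-- The hybrid inclusion `(C, Fs × Ff, D, G)`, i.e. the two-timescale system with parameter
`ε = 1`. -/
def unit (S : TwoTimescaleSystem X Y) : HybridSystem (X × Y) where
  C := S.C
  F := fun x => S.Fs x ×ˢ S.Ff x
  D := S.D
  G := S.G

/-- The mapping whose graph is `graph Λ ∩ A`. -/
def restrictGraph (Λ : X → Set Y) (A : Set (X × Y)) : X → Set Y :=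
  fun x => {y | y ∈ Λ x ∧ (x, y) ∈ A}

/-- The reduced system associated with `S` and `Λ`. -/
def reduced [NormedAddCommGroup X] [NormedSpace ℝ X] (S : TwoTimescaleSystem X Y)
    (Λ : X → Set Y) : HybridSystem X where
  C := domain (restrictGraph Λ S.C)
  F := fun x => closedConvexHull ℝ {v | ∃ y ∈ restrictGraph Λ S.C x, v ∈ S.Fs (x, y)}
  D := domain (restrictGraph Λ S.D)
  G := fun x => {g | ∃ y ∈ restrictGraph Λ S.D x, g ∈ Prod.fst '' S.G (x, y)}

/-- `(Φ, (hs, hf))` is a two-timescale asymptotic simulation of the system `S.unit`. -/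
structure IsTwoTimescaleSimulation [NormedAddCommGroup X] [NormedSpace ℝ X]
    [NormedAddCommGroup Y] [NormedSpace ℝ Y] (S : TwoTimescaleSystem X Y)
    (Φ : HybridSeq (X × Y)) (hs hf : ℕ → ℝ) : Prop where
  isBounded : Φ.IsBounded
  isComplete : Φ.IsComplete
  admissible : TwoTimescaleAdmissible hs hf
  flow : Φ.IsCompleteK → ∃ f : ℕ → X × Y, Bornology.IsBounded (range f) ∧
    outerLimit (fun k => (Φ.toFun k (Φ.jBar k), f k)) ⊆ graph (restrictTo S.unit.F S.unit.C) ∧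
    FlowCloseness (Φ.map Prod.fst) hs (fun k => (f k).1) ∧
    FlowCloseness (Φ.map Prod.snd) hf (fun k => (f k).2)
  jump : Φ.IsCompleteJ →
    outerLimit (fun j => (Φ.toFun (Φ.kBar j) j, Φ.toFun (Φ.kBar j) (j + 1))) ⊆
      graph (restrictTo S.unit.G S.unit.D)

end TwoTimescaleSystem

end HybridInclusion

end

noncomputable section

namespace HybridInclusion

/-! ### Limits along ultrafilters -/

/-! The slow component, listed by total number of steps, is a discrete path (`StepPath`) that
alternates short flow steps and jumps. The fast component enters only through limits: along any
ultrafilter on which the slow state converges, boundedness makes the fast state converge as well,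
and the limit pair lies in `Φ.omegaLimit`, hence in the graph of `Λ`. Limits of slow velocities at
`x` therefore lie in some `Fs (x, y)` with `y` in the `C`-part of `Λ x`, and limits of jumps are
jumps of the reduced system. This is `exists_stepPath`, recorded as `Simulates`; the rest concerns a
single timescale.

Shift such a path to base indices tending to infinity and pass to the limit along an ultrafilter. No
subsequence has to be extracted, because every bounded quantity converges. The attained hybrid times
form a hybrid time domain, the limit states are Lipschitz within each flow phase, and `limitArc` is
a complete arc with values in the limit set. Late flow increments are time-weighted averages of
velocities near `B x`, so one-sided derivatives fall in its closed convex hull; this makes the arc a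
solution (`isSolution_limitArc`).

Choosing the base indices yields the dynamical claims. Base points a hybrid time about `T` before
indices converging to `x` give `weaklyInvariant_omega`. By contradiction, long enough and boundedly
long late stretches of the path are shadowed by solutions in the limit set (`exists_shadowing`);
cutting the path into such stretches gives `internallyChainTransitive_omega`. Finally, chain
transitive sets lie in the flow or jump set, hence in the compact projection of the graph of `Λ`, so
admissible sets `K` exist. -/

theorem exists_tendsto_of_eventually_mem {ι X : Type*} [TopologicalSpace X] {K : Set X}
    (hK : IsCompact K) (U : Ultrafilter ι) {f : ι → X} (h : ∀ᶠ i in U, f i ∈ K) :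
    ∃ z ∈ K, Tendsto f U (𝓝 z) :=
  hK.ultrafilter_le_nhds (U.map f) (le_principal_iff.2 h)

theorem exists_tendsto_of_norm_le {ι E : Type*} [NormedAddCommGroup E] [ProperSpace E]
    (U : Ultrafilter ι) {f : ι → E} {R : ℝ} (h : ∀ i, ‖f i‖ ≤ R) :
    ∃ z, Tendsto f U (𝓝 z) := by
  obtain ⟨z, -, hz⟩ := exists_tendsto_of_eventually_mem (isCompact_closedBall (0 : E) R) U
    (f := f) (Eventually.of_forall fun i => by simpa using h i)
  exact ⟨z, hz⟩

/-! ### Paths made of flow steps and jump steps -/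

/-- A sequence of states, indexed by the total number of steps, in which each step either advances
the ordinary time (a flow step) or increments the number of jumps (a jump step). Flow steps become
short, and along them the states follow the velocities up to an asymptotically negligible error. -/
structure StepPath (E : Type*) [NormedAddCommGroup E] [NormedSpace ℝ E] where
  time : ℕ → ℝ
  jumps : ℕ → ℕ
  pos : ℕ → E
  vel : ℕ → E
  step : ∀ n, (jumps (n + 1) = jumps n ∧ time n ≤ time (n + 1)) ∨
    (jumps (n + 1) = jumps n + 1 ∧ time (n + 1) = time n)
  tendsto_step : Tendsto (fun n => time (n + 1) - time n) atTop (𝓝 0)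
  tendsto_total : Tendsto (fun n => time n + jumps n) atTop atTop
  bounded_pos : ∃ R, ∀ n, ‖pos n‖ ≤ R
  bounded_vel : ∃ R, ∀ n, ‖vel n‖ ≤ R
  closeness : ∀ T ε : ℝ, 0 < ε → ∀ᶠ n in atTop, ∀ m, n ≤ m → jumps m = jumps n →
    time m - time n ≤ T →
      ‖pos m - pos n - ∑ i ∈ Finset.Ico n m, (time (i + 1) - time i) • vel i‖ ≤ ε

namespace StepPath

variable {E : Type*} [NormedAddCommGroup E] [NormedSpace ℝ E] (P : StepPath E)

theorem jumps_mono : Monotone P.jumps :=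
  monotone_nat_of_le_succ fun n => by rcases P.step n with h | h <;> omega

theorem time_mono : Monotone P.time :=
  monotone_nat_of_le_succ fun n => by rcases P.step n with h | h <;> linarith [h.2]

/-- Total hybrid time elapsed after `n` steps. -/
def total (n : ℕ) : ℝ := P.time n + P.jumps n

theorem total_mono : Monotone P.total :=
  fun _ _ h => add_le_add (P.time_mono h) (Nat.cast_le.2 (P.jumps_mono h))

theorem jumps_succ_eq {n m : ℕ} (h : n < m) (hj : P.jumps m = P.jumps n) :
    P.jumps (n + 1) = P.jumps n :=
  le_antisymm ((P.jumps_mono (Nat.succ_le_of_lt h)).trans hj.le) (P.jumps_mono n.le_succ)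

theorem lt_of_jumps_lt {n m : ℕ} (h : P.jumps n < P.jumps m) : n < m :=
  lt_of_not_ge fun h' => absurd (P.jumps_mono h') (not_le.2 h)

/-- A jump adds exactly one unit of hybrid time, and late flow steps are shorter than one. A
crossing of any level thus overshoots by at most one. -/
theorem eventually_total_succ_le : ∀ᶠ n in atTop, ∀ m, n ≤ m → P.total (m + 1) ≤ P.total m + 1 := by
  have h := (P.tendsto_step.eventually (gt_mem_nhds one_pos))
  rw [eventually_atTop] at h
  obtain ⟨N, hN⟩ := h
  filter_upwards [eventually_ge_atTop N] with n hn m hm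
  have h1 := hN m (hn.trans hm)
  unfold total
  rcases P.step m with h | h
  · rw [h.1]; linarith
  · rw [h.1, h.2]; push_cast; linarith

/-- The step at which the number of jumps is first `l`. -/
def entry (l : ℕ) : ℕ := sInf {m | l ≤ P.jumps m}

theorem entry_le {l m : ℕ} (h : l ≤ P.jumps m) : P.entry l ≤ m := Nat.sInf_le h

/-- Jump counts rise by at most one per step, so no level is skipped and the step that first reaches
`l` is itself a jump, at unchanged ordinary time. -/
theorem jumps_entry {l n m : ℕ} (hn : P.jumps n < l) (h : l ≤ P.jumps m) :
    ∃ e, P.entry l = e + 1 ∧ n ≤ e ∧ P.jumps e + 1 = l ∧ P.jumps (e + 1) = l ∧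
      P.time (e + 1) = P.time e := by
  have hmem : l ≤ P.jumps (P.entry l) := Nat.sInf_mem (s := {m | l ≤ P.jumps m}) ⟨m, h⟩
  have hlt : n < P.entry l := P.lt_of_jumps_lt (hn.trans_le hmem)
  obtain ⟨e, he⟩ : ∃ e, P.entry l = e + 1 := ⟨P.entry l - 1, by omega⟩
  have h1 : P.jumps e < l := by
    by_contra! hc
    have := P.entry_le hc
    omega
  rw [he] at hmem
  refine ⟨e, he, by omega, ?_⟩
  rcases P.step e with h | h
  · omega
  · exact ⟨by omega, by omega, h.2⟩

theorem norm_sum_le {L : ℝ} (hL : ∀ n, ‖P.vel n‖ ≤ L) {n m : ℕ} (h : n ≤ m) :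
    ‖∑ i ∈ Finset.Ico n m, (P.time (i + 1) - P.time i) • P.vel i‖ ≤
      L * (P.time m - P.time n) := by
  calc _ ≤ ∑ i ∈ Finset.Ico n m, L * (P.time (i + 1) - P.time i) := by
        refine norm_sum_le_of_le _ fun i _ => ?_
        have h0 : 0 ≤ P.time (i + 1) - P.time i := sub_nonneg.2 (P.time_mono i.le_succ)
        rw [norm_smul, Real.norm_of_nonneg h0, mul_comm]
        exact mul_le_mul_of_nonneg_right (hL i) h0
    _ = _ := by rw [← Finset.mul_sum, Finset.sum_Ico_sub P.time h]

/-- The source of the Lipschitz bound for limit arcs: up to an arbitrarily small error, late states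
within one flow phase move at speed at most `L`. -/
theorem eventually_norm_sub_le {L : ℝ} (hL : ∀ n, ‖P.vel n‖ ≤ L) (T : ℝ) {ε : ℝ} (hε : 0 < ε) :
    ∀ᶠ n in atTop, ∀ m, n ≤ m → P.jumps m = P.jumps n → P.time m - P.time n ≤ T →
      ‖P.pos m - P.pos n‖ ≤ L * (P.time m - P.time n) + ε := by
  filter_upwards [P.closeness T ε hε] with n hn m hnm hj hT
  have h1 := hn m hnm hj hT
  have h2 := P.norm_sum_le hL hnm
  have h3 := norm_le_norm_sub_add (P.pos m - P.pos n)
    (∑ i ∈ Finset.Ico n m, (P.time (i + 1) - P.time i) • P.vel i)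
  linarith

/-! ### Limit points of shifted paths -/

variable {P}
variable {U : Ultrafilter ℕ} {b m m' : ℕ → ℕ} {t t' : ℝ} {j j' : ℕ}

variable (P U) in
/-- Relative to the base indices `b`, the indices `m` have hybrid time `(t, j)` in the limit
along `U`. -/
def Tracks (b m : ℕ → ℕ) (t : ℝ) (j : ℕ) : Prop :=
  (∀ᶠ i in U, b i ≤ m i ∧ P.jumps (m i) = P.jumps (b i) + j) ∧
    Tendsto (fun i => P.time (m i) - P.time (b i)) U (𝓝 t)

theorem tracks_base : P.Tracks U b b 0 0 := ⟨by simp, by simp⟩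

theorem Tracks.nonneg (h : P.Tracks U b m t j) : 0 ≤ t :=
  ge_of_tendsto h.2 (h.1.mono fun _ hi => sub_nonneg.2 (P.time_mono hi.1))

theorem Tracks.tendsto_atTop (hb : Tendsto b U atTop) (h : P.Tracks U b m t j) :
    Tendsto m U atTop :=
  tendsto_atTop_mono' _ (h.1.mono fun _ hi => hi.1) hb

theorem Tracks.time_le (h : P.Tracks U b m t j) (h' : P.Tracks U b m' t' j')
    (hm : ∀ᶠ i in U, m i ≤ m' i) : t ≤ t' :=
  le_of_tendsto_of_tendsto h.2 h'.2 (hm.mono fun _ hi => sub_le_sub_right (P.time_mono hi) _)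

theorem Tracks.tendsto_sub (h : P.Tracks U b m t j) (h' : P.Tracks U b m' t' j') :
    Tendsto (fun i => P.time (m' i) - P.time (m i)) U (𝓝 (t' - t)) :=
  (h'.2.sub h.2).congr fun i => by ring

/-- Of two index sequences with distinct limit times, the one with the earlier time comes first. -/
theorem Tracks.eventually_lt (h : P.Tracks U b m t j) (h' : P.Tracks U b m' t' j')
    (ht : t < t') : ∀ᶠ i in U, m i < m' i := by
  filter_upwards [(h.tendsto_sub h').eventually (lt_mem_nhds (sub_pos.2 ht))] with i hi
  exact lt_of_not_ge fun hc => absurd (P.time_mono hc) (not_le.2 (sub_pos.1 hi))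

/-- A bounded amount of elapsed hybrid time has a limit. -/
theorem exists_tracks {R : ℝ}
    (h : ∀ᶠ i in U, b i ≤ m i ∧ P.total (m i) - P.total (b i) ≤ R) :
    ∃ t j, P.Tracks U b m t j := by
  have hle : ∀ᶠ i in U, b i ≤ m i ∧ 0 ≤ P.time (m i) - P.time (b i) ∧
      P.jumps (b i) ≤ P.jumps (m i) ∧
      (P.time (m i) - P.time (b i)) + (((P.jumps (m i) : ℝ)) - P.jumps (b i)) ≤ R := by
    filter_upwards [h] with i hi
    refine ⟨hi.1, sub_nonneg.2 (P.time_mono hi.1), P.jumps_mono hi.1, ?_⟩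
    have := hi.2
    unfold total at this
    linarith
  obtain ⟨t, -, ht⟩ := exists_tendsto_of_eventually_mem (isCompact_Icc (a := (0 : ℝ)) (b := R)) U
    (f := fun i => P.time (m i) - P.time (b i)) (hle.mono fun i hi => by
      have : (P.jumps (b i) : ℝ) ≤ P.jumps (m i) := Nat.cast_le.2 hi.2.2.1
      exact ⟨hi.2.1, by linarith [hi.2.2.2]⟩)
  -- The number of elapsed jumps takes finitely many values, so it is constant along the
  -- ultrafilter.
  obtain ⟨j, -, hj⟩ := exists_tendsto_of_eventually_mem
    (Set.finite_Iic ⌊R⌋₊).isCompact U (f := fun i => P.jumps (m i) - P.jumps (b i))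
    (hle.mono fun i hi => by
      refine Nat.le_floor ?_
      rw [Nat.cast_sub hi.2.2.1]
      linarith [hi.2.1, hi.2.2.2])
  rw [nhds_discrete, tendsto_pure] at hj
  refine ⟨t, j, ?_, ht⟩
  filter_upwards [hle, hj] with i hi hji
  exact ⟨hi.1, by omega⟩

/-- A step at which a real sequence reaches a level, either the initial one or an up-crossing. -/
theorem exists_crossing {f : ℕ → ℝ} {p q : ℕ} (hpq : p ≤ q) {c : ℝ} (hq : c ≤ f q) :
    ∃ r, p ≤ r ∧ r ≤ q ∧ c ≤ f r ∧ (r = p ∨ ∃ s, r = s + 1 ∧ p ≤ s ∧ f s < c) := by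
  induction q, hpq using Nat.le_induction with
  | base => exact ⟨p, le_rfl, le_rfl, hq, Or.inl rfl⟩
  | succ q hpq ih =>
    by_cases h : c ≤ f q
    · obtain ⟨r, h1, h2, h3⟩ := ih h
      exact ⟨r, h1, h2.trans q.le_succ, h3⟩
    · exact ⟨q + 1, by omega, le_rfl, hq, Or.inr ⟨q, rfl, hpq, not_le.1 h⟩⟩

/-- Intermediate times within a flow phase are attained in the limit. -/
theorem Tracks.exists_intermediate (hb : Tendsto b U atTop) (h : P.Tracks U b m t j)
    {t₂ : ℝ} (h' : P.Tracks U b m' t₂ j)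
    (hm : ∀ᶠ i in U, m i ≤ m' i) {s : ℝ} (hs : s ∈ Icc t t₂) :
    ∃ l, P.Tracks U b l s j := by
  rcases eq_or_lt_of_le hs.1 with rfl | h1
  · exact ⟨m, h⟩
  rcases eq_or_lt_of_le hs.2 with rfl | h2
  · exact ⟨m', h'⟩
  -- Take the first crossing of the level `s`. It overshoots by at most one flow step, whose length
  -- tends to zero.
  have key : ∀ᶠ i in U, ∃ r, m i ≤ r ∧ r ≤ m' i ∧ s ≤ P.time r - P.time (b i) ∧
      ∃ k, r = k + 1 ∧ b i ≤ k ∧ P.time k - P.time (b i) < s := by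
    filter_upwards [h.1, hm, h.2.eventually (gt_mem_nhds h1), h'.2.eventually (lt_mem_nhds h2)]
      with i hi hmi hp hq
    obtain ⟨r, a1, a2, a3, a4⟩ := exists_crossing (f := fun n => P.time n - P.time (b i))
      hmi hq.le
    refine ⟨r, a1, a2, a3, ?_⟩
    rcases a4 with rfl | ⟨k, hk, hk', hk''⟩
    · exact absurd a3 (not_le.2 hp)
    · exact ⟨k, hk, hi.1.trans hk', hk''⟩
  choose! l hl using fun i (hi : ∃ r, m i ≤ r ∧ r ≤ m' i ∧ s ≤ P.time r - P.time (b i) ∧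
      ∃ k, r = k + 1 ∧ b i ≤ k ∧ P.time k - P.time (b i) < s) => hi
  refine ⟨l, ?_, ?_⟩
  · filter_upwards [key, h.1, h'.1] with i hi h1 h2
    have := hl i hi
    exact ⟨h1.1.trans this.1, le_antisymm ((P.jumps_mono this.2.1).trans h2.2.le)
      (h1.2.ge.trans (P.jumps_mono this.1))⟩
  · rw [Metric.tendsto_nhds]
    intro ε hε
    have hst := P.tendsto_step.eventually (gt_mem_nhds hε)
    rw [eventually_atTop] at hst
    obtain ⟨N, hN⟩ := hst
    filter_upwards [key, hb.eventually (eventually_ge_atTop N)] with i hi hbN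
    obtain ⟨-, -, h3, k, hk, hk', hk''⟩ := hl i hi
    have := hN k (hbN.trans hk')
    rw [← hk] at this
    rw [Real.dist_eq, abs_of_nonneg (by linarith)]
    linarith

/-- If the limit time `(t, j)` is attained and `l` earlier or equal jumps have occurred, then the
first index with `l` jumps has a limit time. -/
theorem Tracks.exists_entry (h : P.Tracks U b m t j) {l : ℕ} (hl0 : 0 < l) (hl : l ≤ j) :
    ∃ e : ℕ → ℕ, (∀ᶠ i in U, P.entry (P.jumps (b i) + l) = e i + 1) ∧
      ∃ s, s ≤ t ∧ P.Tracks U b e s (l - 1) ∧ P.Tracks U b (fun i => e i + 1) s l := by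
  have key : ∀ᶠ i in U, ∃ e, P.entry (P.jumps (b i) + l) = e + 1 ∧ b i ≤ e ∧
      P.jumps e + 1 = P.jumps (b i) + l ∧ P.jumps (e + 1) = P.jumps (b i) + l ∧
      P.time (e + 1) = P.time e ∧ e + 1 ≤ m i := by
    filter_upwards [h.1] with i hi
    have hl' : P.jumps (b i) + l ≤ P.jumps (m i) := by omega
    obtain ⟨e, h1, h2, h3, h4, h5⟩ := P.jumps_entry (n := b i) (by omega) hl'
    exact ⟨e, h1, h2, h3, h4, h5, h1 ▸ P.entry_le hl'⟩
  choose! e he using fun i (hi : ∃ e, P.entry (P.jumps (b i) + l) = e + 1 ∧ b i ≤ e ∧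
      P.jumps e + 1 = P.jumps (b i) + l ∧ P.jumps (e + 1) = P.jumps (b i) + l ∧
      P.time (e + 1) = P.time e ∧ e + 1 ≤ m i) => hi
  have he' := key.mono he
  obtain ⟨s, hs, hst⟩ := exists_tendsto_of_eventually_mem
    (isCompact_Icc (a := (0 : ℝ)) (b := t + 1)) U
    (f := fun i => P.time (e i) - P.time (b i)) (by
      filter_upwards [he', h.2.eventually (gt_mem_nhds (lt_add_one t))] with i hi ht
      refine ⟨sub_nonneg.2 (P.time_mono hi.2.1), ?_⟩
      have := P.time_mono ((Nat.le_succ _).trans hi.2.2.2.2.2)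
      linarith)
  have h2 : P.Tracks U b (fun i => e i + 1) s l := by
    refine ⟨he'.mono fun i hi => ⟨hi.2.1.trans (Nat.le_succ _), hi.2.2.2.1⟩, hst.congr' (he'.mono fun i hi => ?_)⟩
    simp only [hi.2.2.2.2.1]
  refine ⟨e, he'.mono fun i hi => hi.1, s, h2.time_le h (he'.mono fun i hi => hi.2.2.2.2.2),
    ⟨he'.mono fun i hi => ⟨hi.2.1, by omega⟩, hst⟩, h2⟩

theorem Tracks.eventually_norm_pos_sub_le (hb : Tendsto b U atTop) (h : P.Tracks U b m t j)
    (h' : P.Tracks U b m' t' j) (hm : ∀ᶠ i in U, m i ≤ m' i) {L : ℝ} (hL : ∀ n, ‖P.vel n‖ ≤ L)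
    {ε : ℝ} (hε : 0 < ε) :
    ∀ᶠ i in U, ‖P.pos (m' i) - P.pos (m i)‖ ≤ L * (P.time (m' i) - P.time (m i)) + ε := by
  filter_upwards [h.1, h'.1, hm, (h.tendsto_atTop hb).eventually
    (P.eventually_norm_sub_le hL (t' - t + 1) hε),
    (h.tendsto_sub h').eventually (gt_mem_nhds (lt_add_one _))] with i h1 h2 h3 h4 h5
  exact h4 _ h3 (h2.2.trans h1.2.symm) h5.le

theorem Tracks.norm_sub_le_of_le (hb : Tendsto b U atTop) (h : P.Tracks U b m t j)
    (h' : P.Tracks U b m' t' j) (hm : ∀ᶠ i in U, m i ≤ m' i) {L : ℝ} (hL : ∀ n, ‖P.vel n‖ ≤ L)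
    {z z' : E} (hz : Tendsto (fun i => P.pos (m i)) U (𝓝 z))
    (hz' : Tendsto (fun i => P.pos (m' i)) U (𝓝 z')) : ‖z' - z‖ ≤ L * (t' - t) := by
  refine le_of_forall_pos_le_add fun ε hε => ?_
  exact le_of_tendsto_of_tendsto (hz'.sub hz).norm
    (((h.tendsto_sub h').const_mul L).add_const ε) (h.eventually_norm_pos_sub_le hb h' hm hL hε)

/-- The ultrafilter decides which of the two index sequences comes first. At `t' = t` the bound
shows that the limit state depends only on the hybrid time, which makes `limitFun` well defined. -/
theorem Tracks.norm_sub_le (hb : Tendsto b U atTop) (h : P.Tracks U b m t j)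
    (h' : P.Tracks U b m' t' j) {L : ℝ} (hL : ∀ n, ‖P.vel n‖ ≤ L)
    {z z' : E} (hz : Tendsto (fun i => P.pos (m i)) U (𝓝 z))
    (hz' : Tendsto (fun i => P.pos (m' i)) U (𝓝 z')) : ‖z' - z‖ ≤ L * |t' - t| := by
  rcases U.em (fun i => m i ≤ m' i) with hm | hm
  · have := h.norm_sub_le_of_le hb h' hm hL hz hz'
    rwa [abs_of_nonneg (sub_nonneg.2 (h.time_le h' hm))]
  · have hm' : ∀ᶠ i in U, m' i ≤ m i := hm.mono fun i hi => (not_le.1 hi).le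
    have := h'.norm_sub_le_of_le hb h hm' hL hz' hz
    rwa [abs_sub_comm, abs_of_nonneg (sub_nonneg.2 (h'.time_le h hm')), norm_sub_rev]

/-! ### The limit arc -/

variable (P U b) in
/-- The hybrid times attained in the limit. -/
def limitDom : Set (ℝ × ℕ) := {p | ∃ m, P.Tracks U b m p.1 p.2}

variable (P U b) in
open Classical in
/-- The limits of the states at the hybrid times attained in the limit. -/
def limitFun (t : ℝ) (j : ℕ) : E :=
  if h : ∃ z m, P.Tracks U b m t j ∧ Tendsto (fun i => P.pos (m i)) U (𝓝 z) then h.choose else 0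

theorem Tracks.tendsto_limitFun [ProperSpace E] (hb : Tendsto b U atTop)
    (h : P.Tracks U b m t j) :
    Tendsto (fun i => P.pos (m i)) U (𝓝 (P.limitFun U b t j)) := by
  obtain ⟨R, hR⟩ := P.bounded_pos
  obtain ⟨L, hL⟩ := P.bounded_vel
  obtain ⟨z, hz⟩ := exists_tendsto_of_norm_le U fun i => hR (m i)
  have hex : ∃ z m, P.Tracks U b m t j ∧ Tendsto (fun i => P.pos (m i)) U (𝓝 z) := ⟨z, m, h, hz⟩
  obtain ⟨m₁, h₁, hz₁⟩ := hex.choose_spec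
  have h0 := h₁.norm_sub_le hb h hL hz₁ hz
  rw [sub_self, abs_zero, mul_zero, norm_le_zero_iff, sub_eq_zero] at h0
  rw [limitFun, dif_pos hex, ← h0]
  exact hz

/-- Phase `l` starts at the limit time of the first index with `l` jumps and ends at that of the
jump to `l + 1`; the last phase is cut at `T`. Times in between are attained by
`exists_intermediate`. -/
theorem isHybridTimeDomain_limitDom (hb : Tendsto b U atTop) :
    IsHybridTimeDomain (P.limitDom U b) := by
  refine ⟨⟨(0, 0), b, tracks_base⟩, ?_⟩
  rintro ⟨T, J⟩ ⟨m, hm⟩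
  simp only at hm
  have key : ∀ l, ∃ e s, 0 < l → l ≤ J → (∀ᶠ i in U, P.entry (P.jumps (b i) + l) = e i + 1) ∧
      s ≤ T ∧ P.Tracks U b e s (l - 1) ∧ P.Tracks U b (fun i => e i + 1) s l := by
    intro l
    by_cases hl : 0 < l ∧ l ≤ J
    · obtain ⟨e, h1, s, h2⟩ := hm.exists_entry hl.1 hl.2
      exact ⟨e, s, fun _ _ => ⟨h1, h2⟩⟩
    · exact ⟨fun _ => 0, 0, fun h1 h2 => absurd ⟨h1, h2⟩ hl⟩
  choose e s hes using key
  -- first and last index sequences of each phase, with their limit times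
  set τ : ℕ → ℝ := fun l => if l = 0 then 0 else if l ≤ J then s l else T with hτ
  have hfirst : ∀ l ≤ J, ∃ a, P.Tracks U b a (τ l) l ∧
      ∀ m' t', P.Tracks U b m' t' l → ∀ᶠ i in U, a i ≤ m' i := by
    intro l hl
    rcases Nat.eq_zero_or_pos l with rfl | hl0
    · exact ⟨b, by simpa [hτ] using tracks_base, fun m' t' h => h.1.mono fun i hi => hi.1⟩
    · obtain ⟨h1, h2, h3, h4⟩ := hes l hl0 hl
      refine ⟨fun i => e l i + 1, by simpa [hτ, hl0.ne', hl] using h4, fun m' t' h => ?_⟩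
      filter_upwards [h1, h.1] with i hi hi'
      rw [← hi]
      exact P.entry_le hi'.2.ge
  have hlast : ∀ l ≤ J, ∃ a, P.Tracks U b a (τ (l + 1)) l ∧
      ∀ m' t', P.Tracks U b m' t' l → l < J → ∀ᶠ i in U, m' i ≤ a i := by
    intro l hl
    rcases eq_or_lt_of_le hl with rfl | hl'
    · exact ⟨m, by simpa [hτ] using hm, fun _ _ _ h => absurd h (lt_irrefl _)⟩
    · obtain ⟨h1, h2, h3, h4⟩ := hes (l + 1) l.succ_pos hl'
      refine ⟨e (l + 1), by simpa [hτ, Nat.succ_le_of_lt hl'] using h3, fun m' t' h _ => ?_⟩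
      -- Indices with only `l` jumps precede the entry `e + 1`, so they are at most `e`.
      filter_upwards [h4.1, h.1] with i hi hi'
      refine Nat.le_of_lt_succ (P.lt_of_jumps_lt ?_)
      rw [hi'.2, Nat.succ_eq_add_one, hi.2]
      omega
  have hle : ∀ l ≤ J, τ l ≤ τ (l + 1) := by
    intro l hl
    obtain ⟨a, ha, ha'⟩ := hfirst l hl
    obtain ⟨c, hc, -⟩ := hlast l hl
    exact ha.time_le hc (ha' _ _ hc)
  refine ⟨J + 1, τ, J.succ_pos, by simp [hτ], fun l hl => hle l (by omega), ?_⟩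
  ext ⟨t, l⟩
  simp only [mem_inter_iff, mem_prod, mem_Icc, mem_Iic, mem_ofPred_eq, limitDom]
  constructor
  · rintro ⟨⟨m', hm'⟩, ⟨h0, hT⟩, hl⟩
    obtain ⟨a, ha, ha'⟩ := hfirst l hl
    obtain ⟨c, hc, hc'⟩ := hlast l hl
    refine ⟨by omega, ha.time_le hm' (ha' _ _ hm'), ?_⟩
    rcases eq_or_lt_of_le hl with rfl | hlt
    · simpa [hτ] using hT
    · exact hm'.time_le hc (hc' _ _ hm' hlt)
  · rintro ⟨hl, h1, h2⟩
    have hl : l ≤ J := by omega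
    obtain ⟨a, ha, ha'⟩ := hfirst l hl
    obtain ⟨c, hc, hc'⟩ := hlast l hl
    refine ⟨ha.exists_intermediate hb hc (ha' _ _ hc) ⟨h1, h2⟩,
      ⟨ha.nonneg.trans h1, h2.trans ?_⟩, hl⟩
    rcases eq_or_lt_of_le hl with rfl | hlt
    · simp [hτ]
    · have : τ (l + 1) = s (l + 1) := by simp [hτ, Nat.succ_le_of_lt hlt]
      rw [this]
      exact (hes (l + 1) l.succ_pos hlt).2.1

theorem lipschitzOnWith_limitFun [ProperSpace E] (hb : Tendsto b U atTop) {L : NNReal}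
    (hL : ∀ n, ‖P.vel n‖ ≤ L) {A : Set ℝ} (hA : A ×ˢ {j} ⊆ P.limitDom U b) :
    LipschitzOnWith L (fun t => P.limitFun U b t j) A := by
  refine LipschitzOnWith.of_dist_le_mul fun x hx y hy => ?_
  obtain ⟨m, hm⟩ := hA (mk_mem_prod hx (mem_singleton j))
  obtain ⟨m', hm'⟩ := hA (mk_mem_prod hy (mem_singleton j))
  rw [dist_eq_norm, Real.dist_eq]
  exact hm'.norm_sub_le hb hm hL (hm'.tendsto_limitFun hb) (hm.tendsto_limitFun hb)

theorem exists_nnreal_vel_le : ∃ L : NNReal, ∀ n, ‖P.vel n‖ ≤ L := by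
  obtain ⟨L, hL⟩ := P.bounded_vel
  exact ⟨⟨L, (norm_nonneg _).trans (hL 0)⟩, hL⟩

variable (P) in
/-- The limit of the shifted paths, as a hybrid arc. -/
def limitArc [ProperSpace E] (hb : Tendsto b U atTop) : HybridArc E where
  dom := P.limitDom U b
  toFun := P.limitFun U b
  isHybridTimeDomain := isHybridTimeDomain_limitDom hb
  absolutelyContinuous := by
    intro j t₁ t₂ h hsub
    obtain ⟨L, hL⟩ := P.exists_nnreal_vel_le
    refine (lipschitzOnWith_limitFun hb hL ?_).absolutelyContinuousOnInterval (K := L)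
    rwa [uIcc_of_le h.le]

/-- An index at which the hybrid time elapsed since `n` lies in `[T, T + 1]`. -/
theorem exists_total_window {n : ℕ} (hn : ∀ m, n ≤ m → P.total (m + 1) ≤ P.total m + 1) {T : ℝ}
    (hT : 0 ≤ T) : ∃ m, n ≤ m ∧ T ≤ P.total m - P.total n ∧ P.total m - P.total n ≤ T + 1 := by
  obtain ⟨q, hq⟩ := ((P.tendsto_total.eventually (eventually_ge_atTop (P.total n + T))).and
    (eventually_ge_atTop n)).exists
  obtain ⟨r, h1, h2, h3, h4⟩ := exists_crossing (f := P.total) hq.2 (c := P.total n + T)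
    hq.1
  refine ⟨r, h1, by linarith, ?_⟩
  rcases h4 with rfl | ⟨k, rfl, hk, hk'⟩
  · linarith
  · linarith [hn k hk]

theorem Tracks.le_of_total {T : ℝ} (h : P.Tracks U b m t j)
    (hT : ∀ᶠ i in U, T ≤ P.total (m i) - P.total (b i)) : T ≤ t + j := by
  refine ge_of_tendsto (h.2.add_const (j : ℝ)) ?_
  filter_upwards [h.1, hT] with i hi hi'
  unfold total at hi'
  rw [hi.2] at hi'
  push_cast at hi'
  linarith

/-- Pick indices at elapsed hybrid time in `[|T|, |T| + 1]`: the upper bound provides a limit time,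
and the lower bound survives in the limit. -/
theorem isComplete_limitArc [ProperSpace E] (hb : Tendsto b U atTop) :
    (P.limitArc hb).IsComplete := by
  intro T
  have h : ∀ᶠ i in U, ∃ m, b i ≤ m ∧ |T| ≤ P.total m - P.total (b i) ∧
      P.total m - P.total (b i) ≤ |T| + 1 :=
    (hb.eventually P.eventually_total_succ_le).mono fun i hi => exists_total_window hi (abs_nonneg T)
  choose! m hm using fun i (hi : ∃ m, b i ≤ m ∧ |T| ≤ P.total m - P.total (b i) ∧
      P.total m - P.total (b i) ≤ |T| + 1) => hi
  have h' := h.mono hm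
  obtain ⟨t, j, htj⟩ := exists_tracks (h'.mono fun i hi => ⟨hi.1, hi.2.2⟩)
  exact ⟨(t, j), ⟨m, htj⟩, (le_abs_self T).trans (htj.le_of_total (h'.mono fun i hi => hi.2.1))⟩

end StepPath

end HybridInclusion

end

noncomputable section

namespace HybridInclusion

namespace StepPath

variable {E : Type*} [NormedAddCommGroup E] [NormedSpace ℝ E] {P : StepPath E}
  {U : Ultrafilter ℕ} {b m m' : ℕ → ℕ} {t t' : ℝ} {j j' : ℕ}

/-! ### The limit arc is a solution -/

variable (P) in
/-- The limits of states and velocities along flow steps, and of consecutive states along jump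
steps, agree with the data of `H`, where `B` is a set-valued map whose closed convex hull is
contained in the flow map. -/
structure Simulates (H : HybridSystem E) (B : E → Set E) : Prop where
  hull_subset : ∀ x, closedConvexHull ℝ (B x) ⊆ H.F x
  flow : ∀ (U : Ultrafilter ℕ) (x v : E), ↑U ≤ (atTop : Filter ℕ) →
    (∀ᶠ n in U, P.jumps (n + 1) = P.jumps n) → Tendsto P.pos U (𝓝 x) →
    Tendsto P.vel U (𝓝 v) → x ∈ H.C ∧ v ∈ B x
  jump : ∀ (U : Ultrafilter ℕ) (x y : E), ↑U ≤ (atTop : Filter ℕ) →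
    (∀ᶠ n in U, P.jumps (n + 1) = P.jumps n + 1) → Tendsto P.pos U (𝓝 x) →
    Tendsto (fun n => P.pos (n + 1)) U (𝓝 y) → x ∈ H.D ∧ y ∈ H.G x

variable {H : HybridSystem E} {B : E → Set E}

theorem Simulates.mem_C_of_flow [ProperSpace E] (hP : P.Simulates H B) {x : E}
    (hm : Tendsto m U atTop) (hf : ∀ᶠ i in U, P.jumps (m i + 1) = P.jumps (m i))
    (hx : Tendsto (fun i => P.pos (m i)) U (𝓝 x)) : x ∈ H.C := by
  obtain ⟨R, hR⟩ := P.bounded_vel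
  obtain ⟨v, hv⟩ := exists_tendsto_of_norm_le U fun i => hR (m i)
  exact (hP.flow (U.map m) x v hm hf hx hv).1

/-- The ultrafilter decides whether the next step is a flow step or a jump, and the corresponding
clause of `Simulates` applies. -/
theorem Simulates.initial_mem [ProperSpace E] (hP : P.Simulates H B) {x : E}
    (hm : Tendsto m U atTop) (hx : Tendsto (fun i => P.pos (m i)) U (𝓝 x)) : x ∈ H.C ∪ H.D := by
  rcases U.em (fun i => P.jumps (m i + 1) = P.jumps (m i)) with h | h
  · exact Or.inl (hP.mem_C_of_flow hm h hx)
  · obtain ⟨R, hR⟩ := P.bounded_pos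
    obtain ⟨y, hy⟩ := exists_tendsto_of_norm_le U fun i => hR (m i + 1)
    refine Or.inr (hP.jump (U.map m) x y hm (h.mono fun i hi => ?_) hx hy).1
    rcases P.step (m i) with h | h
    · exact absurd h.1 hi
    · exact h.1

/-- Near a state, late velocities are close to the values of `B`. -/
theorem Simulates.exists_vel_mem_cthickening [ProperSpace E] (hP : P.Simulates H B) (x : E) {ε : ℝ}
    (hε : 0 < ε) : ∃ r > 0, ∃ N, ∀ n ≥ N, P.jumps (n + 1) = P.jumps n → ‖P.pos n - x‖ ≤ r →
      P.vel n ∈ Metric.cthickening ε (closedConvexHull ℝ (B x)) := by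
  -- Otherwise there are later and later flow steps with states tending to `x` and velocities at
  -- distance from the hull; a limit velocity would nevertheless lie in `B x`.
  by_contra! hc
  have h1 : ∀ i : ℕ, (0 : ℝ) < 1 / (i + 1) := fun i => by positivity
  choose n hn hj hx hv using fun i : ℕ => hc (1 / (i + 1)) (h1 i) i
  set U : Ultrafilter ℕ := hyperfilter ℕ
  have hU : ↑U ≤ (atTop : Filter ℕ) := Nat.hyperfilter_le_atTop
  have hn' : Tendsto n U atTop := (tendsto_atTop_mono hn tendsto_id).mono_left hU
  have hpos : Tendsto (fun i => P.pos (n i)) U (𝓝 x) := by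
    rw [tendsto_iff_norm_sub_tendsto_zero]
    exact squeeze_zero (fun i => norm_nonneg _) hx
      (tendsto_one_div_add_atTop_nhds_zero_nat.mono_left hU)
  obtain ⟨R, hR⟩ := P.bounded_vel
  obtain ⟨v, hvt⟩ := exists_tendsto_of_norm_le U fun i => hR (n i)
  have hvB := (hP.flow (U.map n) x v hn'
    (show ∀ᶠ i in U, P.jumps (n i + 1) = P.jumps (n i) from Eventually.of_forall hj) hpos hvt).2
  have hnear := hvt.eventually (Metric.ball_mem_nhds v hε)
  obtain ⟨i, hi⟩ := hnear.exists
  exact hv i (Metric.mem_cthickening_of_dist_le _ v _ _ (subset_closedConvexHull hvB)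
    (le_of_lt hi))

/-- The time increments divided by the elapsed time are convex weights, by telescoping. -/
theorem weighted_average_mem {K : Set E} (hK : Convex ℝ K) {p q : ℕ} (hpq : p ≤ q)
    (hlt : P.time p < P.time q) (hv : ∀ i ∈ Finset.Ico p q, P.vel i ∈ K) :
    (P.time q - P.time p)⁻¹ •
      ∑ i ∈ Finset.Ico p q, (P.time (i + 1) - P.time i) • P.vel i ∈ K := by
  have hpos : 0 < P.time q - P.time p := sub_pos.2 hlt
  rw [Finset.smul_sum]
  simp_rw [smul_smul]
  refine hK.sum_mem (fun i _ => mul_nonneg (inv_nonneg.2 hpos.le)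
    (sub_nonneg.2 (P.time_mono i.le_succ))) ?_ hv
  rw [← Finset.mul_sum, Finset.sum_Ico_sub P.time hpq, inv_mul_cancel₀ hpos.ne']

/-- On a short time interval the states stay so close to the limit at `t` that all velocities lie in
the thickened hull. Their weighted averages do too by convexity, and these averages converge to the
slope. -/
theorem Simulates.slope_mem [ProperSpace E] (hP : P.Simulates H B) (hb : Tendsto b U atTop)
    (h : P.Tracks U b m t j) {ε : ℝ} (hε : 0 < ε) :
    ∃ δ > 0, ∀ t' m', t < t' → t' ≤ t + δ → P.Tracks U b m' t' j →
      slope (fun s => P.limitFun U b s j) t t' ∈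
        Metric.cthickening ε (closedConvexHull ℝ (B (P.limitFun U b t j))) := by
  set x := P.limitFun U b t j with hx
  have hxm : Tendsto (fun i => P.pos (m i)) U (𝓝 x) := h.tendsto_limitFun hb
  obtain ⟨r, hr, N, hN⟩ := hP.exists_vel_mem_cthickening x hε
  obtain ⟨L, hL⟩ := P.exists_nnreal_vel_le
  have hL0 : (0 : ℝ) < L + 1 := by positivity
  -- The budget `r` is split into initial distance `r / 4`, closeness error `r / 4` and drift `r /
  -- 2`. Elapsed times converge to at most `δ`, hence are eventually below `2 * δ`; `L + 1` keeps
  -- the denominator positive.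
  refine ⟨r / (4 * (L + 1)), by positivity, fun t' m' htt' hle h' => ?_⟩
  set δ := r / (4 * (L + 1 : ℝ)) with hδ
  have hδpos : 0 < δ := by positivity
  have hmul : (L : ℝ) * (2 * δ) ≤ r / 2 := by
    have : (L + 1 : ℝ) * (2 * δ) = r / 2 := by rw [hδ]; field_simp; ring
    nlinarith
  have hlt := h.eventually_lt h' htt'
  have hsub := h.tendsto_sub h'
  -- the averaged velocities converge to the slope
  have hsum : Tendsto (fun i => ∑ l ∈ Finset.Ico (m i) (m' i),
      (P.time (l + 1) - P.time l) • P.vel l) U (𝓝 (P.limitFun U b t' j - x)) := by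
    have h0 : Tendsto (fun i => P.pos (m' i) - P.pos (m i) - ∑ l ∈ Finset.Ico (m i) (m' i),
        (P.time (l + 1) - P.time l) • P.vel l) U (𝓝 0) := by
      rw [Metric.tendsto_nhds]
      intro η hη
      filter_upwards [(h.tendsto_atTop hb).eventually (P.closeness (t' - t + 1) (η / 2)
        (half_pos hη)), hlt, h.1, h'.1, hsub.eventually (gt_mem_nhds (lt_add_one _))]
        with i h1 h2 h3 h4 h5
      rw [dist_zero_right]
      exact (h1 _ h2.le (h4.2.trans h3.2.symm) h5.le).trans_lt (half_lt_self hη)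
    have := ((h'.tendsto_limitFun hb).sub hxm).sub h0
    simpa using this
  have hlim : Tendsto (fun i => (P.time (m' i) - P.time (m i))⁻¹ •
      ∑ l ∈ Finset.Ico (m i) (m' i), (P.time (l + 1) - P.time l) • P.vel l) U
      (𝓝 ((t' - t)⁻¹ • (P.limitFun U b t' j - x))) :=
    (hsub.inv₀ (sub_pos.2 htt').ne').smul hsum
  rw [slope_def_module]
  refine Metric.isClosed_cthickening.mem_of_tendsto hlim ?_
  filter_upwards [hlt, hsub.eventually (lt_mem_nhds (sub_pos.2 htt')),
    hsub.eventually (gt_mem_nhds (show t' - t < 2 * δ by linarith)), h.1, h'.1,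
    (h.tendsto_atTop hb).eventually (P.eventually_norm_sub_le hL (2 * δ)
      (show 0 < r / 4 by positivity)),
    (h.tendsto_atTop hb).eventually (eventually_ge_atTop N),
    hxm.eventually (Metric.ball_mem_nhds x (show 0 < r / 4 by positivity))]
    with i h1 h2 h3 h4 h5 h6 h7 h8
  refine weighted_average_mem (convex_closedConvexHull.cthickening ε) h1.le (by linarith) ?_
  intro l hl
  rw [Finset.mem_Ico] at hl
  have hjl : P.jumps l = P.jumps (m i) :=
    le_antisymm ((P.jumps_mono hl.2.le).trans (h5.2.trans h4.2.symm).le) (P.jumps_mono hl.1)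
  have hjl' : P.jumps (m' i) = P.jumps l := by omega
  have htl := P.time_mono hl.2.le
  refine hN l (le_trans h7 hl.1) (P.jumps_succ_eq hl.2 hjl') ?_
  have h9 := h6 l hl.1 hjl (by linarith)
  have h10 : (L : ℝ) * (P.time l - P.time (m i)) ≤ L * (2 * δ) :=
    mul_le_mul_of_nonneg_left (by linarith) L.2
  have h11 := norm_sub_le_norm_sub_add_norm_sub (P.pos l) (P.pos (m i)) x
  rw [dist_eq_norm] at h8
  linarith

/-- Flow: Lipschitz arcs are differentiable almost everywhere, and each derivative is a limit of
right slopes controlled by `slope_mem`. Jump: the last index before the jump and the one after it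
both track the jump time. -/
theorem Simulates.isSolution_limitArc [FiniteDimensional ℝ E] [ProperSpace E]
    (hP : P.Simulates H B) (hb : Tendsto b U atTop) : H.IsSolution (P.limitArc hb) where
  initial := hP.initial_mem hb (tracks_base.tendsto_limitFun hb)
  flow := by
    intro j t₁ t₂ hlt hsub
    obtain ⟨L, hL⟩ := P.exists_nnreal_vel_le
    have hlip : LipschitzOnWith L (fun t => P.limitFun U b t j) (Icc t₁ t₂) :=
      lipschitzOnWith_limitFun hb hL hsub
    rw [MeasureTheory.ae_restrict_iff' measurableSet_Icc]
    filter_upwards [hlip.ae_differentiableWithinAt_of_mem_real,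
      MeasureTheory.Measure.ae_ne MeasureTheory.volume t₂] with t hd hne ht
    have htlt : t < t₂ := lt_of_le_of_ne ht.2 hne
    obtain ⟨m, hm⟩ := hsub (mk_mem_prod ht (mem_singleton j))
    obtain ⟨m₂, hm₂⟩ := hsub (mk_mem_prod (right_mem_Icc.2 hlt.le) (mem_singleton j))
    refine ⟨hP.mem_C_of_flow (hm.tendsto_atTop hb) ?_ (hm.tendsto_limitFun hb), _, ?_,
      (hd ht).hasDerivWithinAt⟩
    · filter_upwards [hm.eventually_lt hm₂ htlt, hm.1, hm₂.1] with i h1 h2 h3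
      exact P.jumps_succ_eq h1 (h3.2.trans h2.2.symm)
    · refine hP.hull_subset _ ?_
      -- Slopes are controlled only to the right of `t`; this is why the endpoint `t₂` was discarded
      -- as a null set.
      have hder := (hd ht).hasDerivWithinAt.mono_of_mem_nhdsWithin
        (show Icc t₁ t₂ ∈ 𝓝[Ioi t] t from
          mem_of_superset (Ioc_mem_nhdsGT htlt) fun s hs => ⟨ht.1.trans hs.1.le, hs.2⟩)
      rw [hasDerivWithinAt_iff_tendsto_slope' self_notMem_Ioi] at hder
      rw [← isClosed_closedConvexHull.closure_eq, Metric.closure_eq_iInter_cthickening]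
      refine mem_iInter₂.2 fun ε hε => ?_
      obtain ⟨δ, hδ, hslope⟩ := hP.slope_mem hb hm hε
      refine Metric.isClosed_cthickening.mem_of_tendsto hder ?_
      filter_upwards [Ioc_mem_nhdsGT (show t < min t₂ (t + δ) from lt_min htlt (by linarith))]
        with s hs
      obtain ⟨m', hm'⟩ := hsub (mk_mem_prod (show s ∈ Icc t₁ t₂ from
        ⟨ht.1.trans hs.1.le, hs.2.trans (min_le_left _ _)⟩) (mem_singleton j))
      exact hslope s m' hs.1 (hs.2.trans (min_le_right _ _)) hm'
  jump := by
    rintro t j ⟨m, hm⟩ ⟨m', hm'⟩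
    simp only at hm hm'
    obtain ⟨e, he, s, hs, h1, h2⟩ := hm'.exists_entry j.succ_pos le_rfl
    rw [Nat.succ_eq_add_one, Nat.add_sub_cancel] at h1
    -- The entry to `j + 1` jumps comes after `m` and no later than `m'`, both at limit time `t`, so
    -- its limit time is `t`.
    have hts : t ≤ s := hm.time_le h2 (by
      filter_upwards [hm.1, h2.1] with i hi hi'
      exact (P.lt_of_jumps_lt (by rw [hi.2, hi'.2]; omega)).le)
    obtain rfl : s = t := le_antisymm hs hts
    have hj : ∀ᶠ i in U, P.jumps (e i + 1) = P.jumps (e i) + 1 := by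
      filter_upwards [h1.1, h2.1] with i hi hi'
      rw [hi'.2, hi.2]
      rfl
    exact hP.jump (U.map e) _ _ (h1.tendsto_atTop hb) hj (h1.tendsto_limitFun hb)
      (h2.tendsto_limitFun hb)

/-! ### The limit set -/

variable (P) in
/-- The set of accumulation points of the states. -/
def omega : Set E := outerLimit P.pos

theorem mem_omega_of_tendsto {z : E} (hm : Tendsto m U atTop)
    (hz : Tendsto (fun i => P.pos (m i)) U (𝓝 z)) : z ∈ P.omega :=
  mapClusterPt_iff_ultrafilter.2 ⟨U.map m, hm, hz⟩

theorem exists_ultrafilter_of_mem_omega {z : E} (hz : z ∈ P.omega) :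
    ∃ U : Ultrafilter ℕ, ↑U ≤ (atTop : Filter ℕ) ∧ Tendsto P.pos U (𝓝 z) :=
  mapClusterPt_iff_ultrafilter.1 hz

theorem limitArc_mem_omega [ProperSpace E] (hb : Tendsto b U atTop) :
    ∀ p ∈ (P.limitArc hb).dom, (P.limitArc hb).toFun p.1 p.2 ∈ P.omega := by
  rintro ⟨t, j⟩ ⟨m, hm⟩
  exact mem_omega_of_tendsto (hm.tendsto_atTop hb) (hm.tendsto_limitFun hb)

theorem omega_nonempty [ProperSpace E] : P.omega.Nonempty := by
  obtain ⟨R, hR⟩ := P.bounded_pos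
  obtain ⟨z, hz⟩ := exists_tendsto_of_norm_le (hyperfilter ℕ) hR
  exact ⟨z, mem_omega_of_tendsto (m := id) Nat.hyperfilter_le_atTop hz⟩

theorem isCompact_omega [ProperSpace E] : IsCompact P.omega := by
  obtain ⟨R, hR⟩ := P.bounded_pos
  refine (isCompact_closedBall (0 : E) R).of_isClosed_subset isClosed_setOfPred_clusterPt ?_
  intro z hz
  obtain ⟨U, -, hz⟩ := exists_ultrafilter_of_mem_omega hz
  exact Metric.isClosed_closedBall.mem_of_tendsto hz
    (Eventually.of_forall fun n => by simpa using hR n)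

/-- Start the limit arc a hybrid time about `T` before indices whose states converge to `x`; the arc
then passes through `x` at hybrid time at least `T`. -/
theorem Simulates.weaklyInvariant_omega [FiniteDimensional ℝ E] [ProperSpace E]
    (hP : P.Simulates H B) : H.WeaklyInvariant P.omega := by
  refine ⟨isCompact_omega, fun x hx T hT => ?_⟩
  obtain ⟨U, hU, hxU⟩ := exists_ultrafilter_of_mem_omega hx
  obtain ⟨N, hN⟩ := eventually_atTop.1 P.eventually_total_succ_le
  -- a starting index that precedes `n` by an amount of hybrid time in `[T, T + 1]`
  have key : ∀ᶠ n in atTop, ∃ s ≤ n, T ≤ P.total n - P.total s ∧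
      P.total n - P.total s ≤ T + 1 := by
    filter_upwards [eventually_ge_atTop N,
      P.tendsto_total.eventually (eventually_ge_atTop (P.total N + T))] with n hn hnT
    obtain ⟨r, h1, h2, h3, h4⟩ := exists_crossing (f := P.total) hn (c := P.total n - T)
      (by linarith)
    rcases h4 with rfl | ⟨k, rfl, hk, hk'⟩
    · have : P.total r + T ≤ P.total n := hnT
      exact ⟨r, hn, by linarith, by linarith⟩
    · exact ⟨k, by omega, by linarith, by linarith [hN N le_rfl k hk]⟩
  choose! b hb using fun n (hn : ∃ s ≤ n, T ≤ P.total n - P.total s ∧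
      P.total n - P.total s ≤ T + 1) => hn
  have hb' := key.mono hb
  -- The gap to `n` is at most `T + 1` in hybrid time while the total diverges.
  have hbt : Tendsto b atTop atTop := by
    refine tendsto_atTop.2 fun M => ?_
    filter_upwards [hb', P.tendsto_total.eventually (eventually_gt_atTop (P.total M + T + 1))]
      with n hn hnM
    by_contra! hc
    have := P.total_mono hc.le
    have h' : P.total M + T + 1 < P.total n := hnM
    linarith [hn.2.2]
  have hbU : Tendsto b U atTop := hbt.mono_left hU
  have hbU' := hb'.filter_mono hU
  obtain ⟨t, j, htj⟩ := exists_tracks (P := P) (m := id) (hbU'.mono fun i hi => ⟨hi.1, hi.2.2⟩)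
  refine ⟨P.limitArc hbU, hP.isSolution_limitArc hbU, isComplete_limitArc hbU,
    limitArc_mem_omega hbU, (t, j), ⟨id, htj⟩, htj.le_of_total (hbU'.mono fun i hi => hi.2.1), ?_⟩
  exact tendsto_nhds_unique (htj.tendsto_limitFun hbU) hxU

/-! ### Chain transitivity of the limit set -/

/-- Two late indices separated by a bounded amount of hybrid time are shadowed by a solution in
the limit set. -/
theorem Simulates.exists_shadowing [FiniteDimensional ℝ E] [ProperSpace E]
    (hP : P.Simulates H B) (τ R : ℝ) {ε : ℝ} (hε : 0 < ε) :
    ∃ N, ∀ n ≥ N, ∀ m, n ≤ m → τ ≤ P.total m - P.total n → P.total m - P.total n ≤ R →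
      ∃ ψ : HybridArc E, H.IsSolution ψ ∧ (∀ p ∈ ψ.dom, ψ.toFun p.1 p.2 ∈ P.omega) ∧
        dist (ψ.toFun 0 0) (P.pos n) ≤ ε ∧
        ∃ q ∈ ψ.dom, τ ≤ q.1 + q.2 ∧ dist (ψ.toFun q.1 q.2) (P.pos m) ≤ ε := by
  by_contra! hc
  choose n hn m hnm hτ hR hbad using hc
  set U : Ultrafilter ℕ := hyperfilter ℕ
  have hU : ↑U ≤ (atTop : Filter ℕ) := Nat.hyperfilter_le_atTop
  have hb : Tendsto n U atTop := (tendsto_atTop_mono hn tendsto_id).mono_left hU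
  obtain ⟨t, j, htj⟩ := exists_tracks (P := P) (U := U) (b := n) (m := m)
    (Eventually.of_forall fun i => ⟨hnm i, hR i⟩)
  have h0 : Tendsto (fun i => P.pos (n i)) U (𝓝 ((P.limitArc hb).toFun 0 0)) :=
    tracks_base.tendsto_limitFun hb
  have h1 : Tendsto (fun i => P.pos (m i)) U (𝓝 ((P.limitArc hb).toFun t j)) :=
    htj.tendsto_limitFun hb
  obtain ⟨i, hi0, hi1⟩ := ((h0.eventually (Metric.ball_mem_nhds _ hε)).and
    (h1.eventually (Metric.ball_mem_nhds _ hε))).exists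
  refine absurd (hbad i (P.limitArc hb) (hP.isSolution_limitArc hb) (limitArc_mem_omega hb)
    (by rw [dist_comm]; exact le_of_lt hi0) (t, j) ⟨m, htj⟩
    (htj.le_of_total (Eventually.of_forall hτ))) (not_lt.2 ?_)
  rw [dist_comm]
  exact le_of_lt hi1

end StepPath

/-! ### Assembling internal chains link by link -/

section Chains

variable {E : Type*} [NormedAddCommGroup E] [NormedSpace ℝ E] {H : HybridSystem E} {K : Set E}
  {τ ε : ℝ} {a b c : E}

theorem HybridSystem.hasInternalChain_of_solution {ψ : HybridArc E} (hψ : H.IsSolution ψ)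
    (hK : ∀ p ∈ ψ.dom, ψ.toFun p.1 p.2 ∈ K) {q : ℝ × ℕ} (hq : q ∈ ψ.dom) (hτ : τ ≤ q.1 + q.2)
    (hb : dist b (ψ.toFun q.1 q.2) ≤ ε) : H.HasInternalChain K τ ε (ψ.toFun 0 0) b := by
  refine ⟨1, fun k => if k = 0 then ψ.toFun 0 0 else b, fun _ => ψ, fun _ => q, one_pos,
    by simp, by simp, fun k hk => ?_⟩
  obtain rfl : k = 0 := by omega
  exact ⟨hψ, by simp, hq, hτ, by simpa using hb, fun p hp _ => hK p hp⟩

theorem HybridSystem.HasInternalChain.cons {ψ : HybridArc E} (hψ : H.IsSolution ψ)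
    (hK : ∀ p ∈ ψ.dom, ψ.toFun p.1 p.2 ∈ K) {q : ℝ × ℕ} (hq : q ∈ ψ.dom) (hτ : τ ≤ q.1 + q.2)
    (hc : dist c (ψ.toFun q.1 q.2) ≤ ε) (h : H.HasInternalChain K τ ε c b) :
    H.HasInternalChain K τ ε (ψ.toFun 0 0) b := by
  obtain ⟨n, x, χ, r, hn, h0, hnb, hlink⟩ := h
  refine ⟨n + 1, fun k => k.casesOn (ψ.toFun 0 0) x, fun k => k.casesOn ψ χ,
    fun k => k.casesOn q r, n.succ_pos, rfl, hnb, fun k hk => ?_⟩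
  cases k with
  | zero => exact ⟨hψ, rfl, hq, hτ, by simpa [h0] using hc, fun p hp _ => hK p hp⟩
  | succ k => exact hlink k (by omega)

end Chains

namespace StepPath

variable {E : Type*} [NormedAddCommGroup E] [NormedSpace ℝ E] {P : StepPath E}
  {H : HybridSystem E} {B : E → Set E}

/-- Follow the path from an index near `a` to a later one near `b`, and replace each stretch by a
shadowing solution. Only the first link must start exactly at a prescribed point, so it is a limit
arc based at indices converging to `a`. -/
theorem Simulates.internallyChainTransitive_omega [FiniteDimensional ℝ E] [ProperSpace E]
    (hP : P.Simulates H B) : H.InternallyChainTransitive P.omega := by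
  intro a ha b hb τ ε hτ hε
  have hε3 : 0 < ε / 3 := by positivity
  -- With more than `2 * τ + 1` left, cutting off a stretch of length in `[τ, τ + 1]` leaves at
  -- least `τ`; otherwise the remainder is a single last link.
  obtain ⟨N₁, hN₁⟩ := hP.exists_shadowing τ (2 * τ + 1) hε3
  obtain ⟨N₂, hN₂⟩ := eventually_atTop.1 P.eventually_total_succ_le
  obtain ⟨U, hU, haU⟩ := exists_ultrafilter_of_mem_omega ha
  -- a first solution that starts at `a`
  have key : ∀ᶠ n in U, ∃ m, n ≤ m ∧ τ ≤ P.total m - P.total n ∧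
      P.total m - P.total n ≤ τ + 1 := by
    filter_upwards [hU (eventually_ge_atTop N₂)] with n hn
    exact exists_total_window (hN₂ n hn) hτ.le
  choose! m hm using fun n (hn : ∃ m, n ≤ m ∧ τ ≤ P.total m - P.total n ∧
      P.total m - P.total n ≤ τ + 1) => hn
  have hm' := key.mono hm
  have hid : Tendsto (id : ℕ → ℕ) U atTop := hU
  obtain ⟨t, j, htj⟩ := exists_tracks (P := P) (b := id) (hm'.mono fun i hi => ⟨hi.1, hi.2.2⟩)
  have hψa : (P.limitArc hid).toFun 0 0 = a :=
    tendsto_nhds_unique (tracks_base.tendsto_limitFun hid) haU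
  have hlim : Tendsto (fun i => P.pos (m i)) U (𝓝 ((P.limitArc hid).toFun t j)) :=
    htj.tendsto_limitFun hid
  obtain ⟨i, hi, hiN⟩ := ((hlim.eventually (Metric.ball_mem_nhds _ hε3)).and
    ((htj.tendsto_atTop hid).eventually (eventually_ge_atTop (max N₁ N₂)))).exists
  -- a late index whose state is close to `b`
  obtain ⟨V, hV, hbV⟩ := exists_ultrafilter_of_mem_omega hb
  obtain ⟨M, hMb, hMτ⟩ := ((hbV.eventually (Metric.ball_mem_nhds _ hε3)).and
    (hV (P.tendsto_total.eventually (eventually_ge_atTop (P.total (m i) + τ))))).exists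
  -- Induction on the number of steps left to `M`. The start `c` is only near `P.pos n`; at each
  -- junction two errors of `ε / 3` add up to less than `ε`.
  have chain : ∀ d n, M - n ≤ d → max N₁ N₂ ≤ n → τ ≤ P.total M - P.total n →
      ∃ c, dist c (P.pos n) ≤ ε / 3 ∧ H.HasInternalChain P.omega τ ε c b := by
    intro d
    induction d with
    | zero =>
      intro n hd _ hn
      have := P.total_mono (show M ≤ n by omega)
      linarith
    | succ d ih =>
      intro n hd hnN hn
      have hnM : n ≤ M := by
        by_contra! hc
        have := P.total_mono hc.le
        linarith
      by_cases hlong : P.total M - P.total n ≤ 2 * τ + 1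
      · obtain ⟨ψ, h1, h2, h3, q, hq, h4, h5⟩ :=
          hN₁ n (le_trans (le_max_left _ _) hnN) M hnM hn hlong
        refine ⟨_, h3, HybridSystem.hasInternalChain_of_solution h1 h2 hq h4 ?_⟩
        have := dist_triangle b (P.pos M) (ψ.toFun q.1 q.2)
        rw [dist_comm] at hMb h5
        linarith
      · obtain ⟨l, h1, h2, h3⟩ := exists_total_window
          (hN₂ n (le_trans (le_max_right _ _) hnN)) hτ.le
        have hnl : n < l := by
          rcases eq_or_lt_of_le h1 with rfl | h
          · linarith
          · exact h
        obtain ⟨c, hc, hchain⟩ := ih l (by omega) (hnN.trans h1) (by linarith)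
        obtain ⟨ψ, g1, g2, g3, q, hq, g4, g5⟩ :=
          hN₁ n (le_trans (le_max_left _ _) hnN) l h1 h2 (by linarith)
        refine ⟨_, g3, hchain.cons g1 g2 hq g4 ?_⟩
        have := dist_triangle c (P.pos l) (ψ.toFun q.1 q.2)
        rw [dist_comm] at g5
        linarith
  have hMτ' : P.total (m i) + τ ≤ P.total M := hMτ
  obtain ⟨c, hc, hchain⟩ := chain _ (m i) le_rfl hiN (by linarith)
  rw [← hψa]
  refine hchain.cons (hP.isSolution_limitArc hid) (limitArc_mem_omega hid)
    (q := (t, j)) ⟨m, htj⟩ (htj.le_of_total (hm'.mono fun i hi => hi.2.1)) ?_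
  have := dist_triangle c (P.pos (m i)) ((P.limitArc hid).toFun t j)
  simp only
  linarith

end StepPath

end HybridInclusion

end

noncomputable section

namespace HybridInclusion

/-! ### Enumeration of hybrid sequence domains -/

/-- Applied to the `k`- and `j`-coordinates, this separates completeness in a direction from the
case where steps of that kind eventually stop. -/
theorem tendsto_atTop_or_eventually_eq {f : ℕ → ℕ} (hf : Monotone f) :
    Tendsto f atTop atTop ∨ ∃ c, ∀ᶠ n in atTop, f n = c := by
  by_cases hb : BddAbove (range f)
  · have := tendsto_atTop_ciSup hf hb
    rw [nhds_discrete, tendsto_pure] at this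
    exact Or.inr ⟨_, this⟩
  · exact Or.inl (tendsto_atTop_atTop_of_monotone' hf hb)

namespace HybridSeq

variable {E : Type*} {φ : HybridSeq E}

/-- By monotonicity both points lie in one compact domain of the union, where the breakpoints `κ`
are nondecreasing. -/
theorem fst_le_of_snd_lt {p q : ℕ × ℕ} (hp : p ∈ φ.dom) (hq : q ∈ φ.dom) (h : p.2 < q.2) :
    p.1 ≤ q.1 := by
  obtain ⟨A, hmono, hA, hE⟩ := φ.isHybridSeqDomain
  rw [hE, mem_iUnion] at hp hq
  obtain ⟨a, ha⟩ := hp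
  obtain ⟨c, hc⟩ := hq
  have ha' := hmono (le_max_left a c) ha
  have hc' := hmono (le_max_right a c) hc
  obtain ⟨J, κ, -, -, hκ, hAκ⟩ := hA (max a c)
  rw [hAκ] at ha' hc'
  have key : ∀ l, p.2 + 1 ≤ l → l ≤ J → κ (p.2 + 1) ≤ κ l := by
    intro l hl
    induction l, hl using Nat.le_induction with
    | base => exact fun _ => le_rfl
    | succ l hl ih => exact fun hJ => (ih (by omega)).trans (hκ l (by omega))
  exact ha'.2.2.trans ((key q.2 h hc'.1.le).trans hc'.2.1)

theorem exists_pred {p : ℕ × ℕ} (hp : p ∈ φ.dom) (h : 0 < p.1 + p.2) :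
    ∃ q ∈ φ.dom, p = (q.1 + 1, q.2) ∨ p = (q.1, q.2 + 1) := by
  obtain ⟨A, hmono, hA, hE⟩ := φ.isHybridSeqDomain
  rw [hE, mem_iUnion] at hp
  obtain ⟨a, ha⟩ := hp
  obtain ⟨J, κ, -, h0, hκ, hAκ⟩ := hA a
  have hsub : A a ⊆ φ.dom := hE ▸ subset_iUnion A a
  rw [hAκ] at ha hsub
  obtain ⟨k, j⟩ := p
  obtain ⟨h1, h2, h3⟩ : j < J ∧ κ j ≤ k ∧ k ≤ κ (j + 1) := ha
  simp only at h
  rcases eq_or_lt_of_le h2 with h4 | h4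
  · cases j with
    | zero => omega
    | succ j =>
      have := hκ j (by omega)
      exact ⟨(k, j), hsub (show j < J ∧ κ j ≤ k ∧ k ≤ κ (j + 1) by omega), Or.inr rfl⟩
  · cases k with
    | zero => omega
    | succ k =>
      exact ⟨(k, j), hsub (show j < J ∧ κ j ≤ k ∧ k ≤ κ (j + 1) by omega), Or.inl rfl⟩

/-- The domain is a staircase, so it meets each antidiagonal at most once; the total `k + j` is thus
a legitimate index. -/
theorem eq_of_sum_eq {p q : ℕ × ℕ} (hp : p ∈ φ.dom) (hq : q ∈ φ.dom)
    (h : p.1 + p.2 = q.1 + q.2) : p = q := by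
  rcases lt_trichotomy p.2 q.2 with h1 | h1 | h1
  · have := fst_le_of_snd_lt hp hq h1
    omega
  · exact Prod.ext (by omega) h1
  · have := fst_le_of_snd_lt hq hp h1
    omega

theorem IsComplete.exists_mem (hφ : φ.IsComplete) (n : ℕ) : ∃ p ∈ φ.dom, p.1 + p.2 = n := by
  obtain ⟨p, hp, hn⟩ := hφ n
  obtain ⟨d, hd⟩ := Nat.exists_eq_add_of_le hn
  induction d generalizing p with
  | zero => exact ⟨p, hp, hd⟩
  | succ d ih =>
    obtain ⟨q, hq, h⟩ := exists_pred hp (by omega)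
    have hs : q.1 + q.2 + 1 = p.1 + p.2 := by
      rcases h with rfl | rfl
      · simp only; omega
      · simp only; omega
    exact ih q hq (by omega) (by omega)

variable (φ) in
/-- The point of the domain that is reached after `n` steps. -/
def point (n : ℕ) : ℕ × ℕ := Classical.epsilon fun p => p ∈ φ.dom ∧ p.1 + p.2 = n

theorem IsComplete.point_spec (hφ : φ.IsComplete) (n : ℕ) :
    φ.point n ∈ φ.dom ∧ (φ.point n).1 + (φ.point n).2 = n :=
  Classical.epsilon_spec (hφ.exists_mem n)

theorem IsComplete.point_sum (hφ : φ.IsComplete) {p : ℕ × ℕ} (hp : p ∈ φ.dom) :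
    φ.point (p.1 + p.2) = p :=
  eq_of_sum_eq (hφ.point_spec _).1 hp (hφ.point_spec _).2

theorem IsComplete.point_succ (hφ : φ.IsComplete) (n : ℕ) :
    φ.point (n + 1) = ((φ.point n).1 + 1, (φ.point n).2) ∨
      φ.point (n + 1) = ((φ.point n).1, (φ.point n).2 + 1) := by
  obtain ⟨h1, h2⟩ := hφ.point_spec (n + 1)
  obtain ⟨q, hq, h⟩ := exists_pred h1 (by omega)
  have hs : q.1 + q.2 + 1 = (φ.point (n + 1)).1 + (φ.point (n + 1)).2 := by
    rcases h with h | h <;> rw [h] <;> simp only <;> omega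
  have : q = φ.point n := eq_of_sum_eq hq (hφ.point_spec n).1 (by
    rw [(hφ.point_spec n).2]; omega)
  rwa [← this]

theorem IsComplete.point_fst_mono (hφ : φ.IsComplete) : Monotone fun n => (φ.point n).1 :=
  monotone_nat_of_le_succ fun n => by
    rcases hφ.point_succ n with h | h <;> rw [h]
    exact Nat.le_succ _

theorem IsComplete.point_snd_mono (hφ : φ.IsComplete) : Monotone fun n => (φ.point n).2 :=
  monotone_nat_of_le_succ fun n => by
    rcases hφ.point_succ n with h | h <;> rw [h]
    exact Nat.le_succ _

theorem IsComplete.isCompleteK (hφ : φ.IsComplete)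
    (h : Tendsto (fun n => (φ.point n).1) atTop atTop) : φ.IsCompleteK := fun N => by
  obtain ⟨n, hn⟩ := (h.eventually (eventually_ge_atTop N)).exists
  exact ⟨_, (hφ.point_spec n).1, hn⟩

theorem IsComplete.isCompleteJ (hφ : φ.IsComplete)
    (h : Tendsto (fun n => (φ.point n).2) atTop atTop) : φ.IsCompleteJ := fun N => by
  obtain ⟨n, hn⟩ := (h.eventually (eventually_ge_atTop N)).exists
  exact ⟨_, (hφ.point_spec n).1, hn⟩

theorem IsComplete.point_succ_of_flow (hφ : φ.IsComplete) {n : ℕ}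
    (h : (φ.point (n + 1)).2 = (φ.point n).2) :
    φ.point (n + 1) = ((φ.point n).1 + 1, (φ.point n).2) := by
  rcases hφ.point_succ n with h' | h'
  · exact h'
  · rw [h'] at h
    simp at h

theorem IsComplete.point_succ_of_jump (hφ : φ.IsComplete) {n : ℕ}
    (h : (φ.point (n + 1)).2 = (φ.point n).2 + 1) :
    φ.point (n + 1) = ((φ.point n).1, (φ.point n).2 + 1) := by
  rcases hφ.point_succ n with h' | h'
  · rw [h'] at h
    simp at h
  · exact h'

/-- Identifies the sampling points of the flow condition with the enumerated flow steps: no point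
`(k + 1, l)` with smaller `l` can precede `(k, j)`. -/
theorem IsComplete.jBar_point (hφ : φ.IsComplete) {n : ℕ}
    (h : (φ.point (n + 1)).2 = (φ.point n).2) : φ.jBar (φ.point n).1 = (φ.point n).2 := by
  have hmem := (hφ.point_spec (n + 1)).1
  rw [hφ.point_succ_of_flow h] at hmem
  refine le_antisymm (Nat.sInf_le hmem) (le_csInf ⟨_, hmem⟩ fun l hl => ?_)
  by_contra! hc
  have := fst_le_of_snd_lt hl (hφ.point_spec n).1 hc
  simp only at this
  omega

theorem IsComplete.kBar_point (hφ : φ.IsComplete) {n : ℕ}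
    (h : (φ.point (n + 1)).2 = (φ.point n).2 + 1) : φ.kBar (φ.point n).2 = (φ.point n).1 := by
  have hmem := (hφ.point_spec (n + 1)).1
  rw [hφ.point_succ_of_jump h] at hmem
  exact le_antisymm (Nat.sInf_le hmem) (le_csInf ⟨_, hmem⟩ fun l hl =>
    fst_le_of_snd_lt (hφ.point_spec n).1 hl (Nat.lt_succ_self _))

theorem IsComplete.omegaLimit_eq [TopologicalSpace E] (hφ : φ.IsComplete) :
    φ.omegaLimit = outerLimit fun n => φ.toFun (φ.point n).1 (φ.point n).2 := by
  ext z
  simp only [omegaLimit, outerLimit, mem_iInter, mem_closure_iff_nhds, mem_ofPred_eq,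
    mapClusterPt_iff_frequently, frequently_atTop]
  constructor
  · intro h s hs i
    obtain ⟨y, hy, p, hp, hi, rfl⟩ := h i s hs
    exact ⟨p.1 + p.2, hi, by rwa [hφ.point_sum hp]⟩
  · intro h i s hs
    obtain ⟨n, hn, hns⟩ := h s hs i
    exact ⟨_, hns, _, (hφ.point_spec n).1, by rwa [(hφ.point_spec n).2], rfl⟩

theorem IsComplete.exists_norm_le [SeminormedAddCommGroup E] (hφ : φ.IsComplete)
    (hb : φ.IsBounded) : ∃ R, ∀ n, ‖φ.toFun (φ.point n).1 (φ.point n).2‖ ≤ R := by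
  obtain ⟨R, hR⟩ := isBounded_iff_forall_norm_le.1 hb
  exact ⟨R, fun n => hR _ ⟨_, (hφ.point_spec n).1, rfl⟩⟩

end HybridSeq

/-! ### Accumulated time -/

theorem accTime_succ (h : ℕ → ℝ) (k : ℕ) : accTime h (k + 1) = accTime h k + h (k + 1) :=
  Finset.sum_range_succ _ _

theorem Admissible.tendsto_accTime {h : ℕ → ℝ} (hh : Admissible h) :
    Tendsto (accTime h) atTop atTop :=
  (not_summable_iff_tendsto_nat_atTop_of_nonneg fun k => (hh.pos (k + 1) (by omega)).le).1
    hh.not_summable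

/-- Divergence of the accumulated time bounds the index set, so the supremum in `lastIndex` is not
the default value `0`. -/
theorem Admissible.le_lastIndex {h : ℕ → ℝ} (hh : Admissible h) {k : ℕ} {t : ℝ}
    (hk : accTime h k ≤ t) : k ≤ lastIndex h t := by
  refine le_csSup ?_ hk
  obtain ⟨N, hN⟩ := eventually_atTop.1 (hh.tendsto_accTime.eventually (eventually_gt_atTop t))
  refine ⟨N, fun l hl => ?_⟩
  by_contra! hc
  exact absurd (show accTime h l ≤ t from hl) (not_le.2 (hN l hc.le))

theorem FlowCloseness.eventually_le {E : Type*} [NormedAddCommGroup E] [NormedSpace ℝ E]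
    {φ : HybridSeq E} {h : ℕ → ℝ} {f : ℕ → E} (hc : FlowCloseness φ h f) (hh : Admissible h)
    (T : ℝ) {ε : ℝ} (hε : 0 < ε) :
    ∀ᶠ k in atTop, ∀ l, k < l → accTime h l - accTime h k ≤ T →
      ‖∑ i ∈ Finset.Ico k l, h (i + 1) • (φ.diffQuot h i - f i)‖ ≤ ε := by
  -- The closeness condition needs a positive window, and a larger window covers a smaller one.
  have h1 := hc (max T 1) (lt_max_of_lt_right one_pos)
  filter_upwards [h1.eventually (gt_mem_nhds hε)] with k hk l hkl hT
  refine le_trans (le_csSup ((finite_Icc _ _).image _).bddAbove ?_) hk.le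
  exact ⟨l, ⟨hkl, hh.le_lastIndex (by linarith [le_max_left T 1])⟩, rfl⟩

/-! ### From hybrid sequences to step paths -/

section ToStepPath

variable {E : Type*} [NormedAddCommGroup E] [NormedSpace ℝ E]

/-- If `k` is unbounded, then within a flow phase step number and `k` differ by a constant, and
telescoping turns the claim into the hypothesis on difference quotients. If `k` is eventually
constant, late phases contain no flow step and `m = n`. -/
theorem HybridSeq.IsComplete.closeness {φ : HybridSeq E} (hφ : φ.IsComplete) {h : ℕ → ℝ}
    (hh : Admissible h) {f : ℕ → E} (hc : φ.IsCompleteK → FlowCloseness φ h f) (T : ℝ) {ε : ℝ}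
    (hε : 0 < ε) :
    ∀ᶠ n in atTop, ∀ m, n ≤ m → (φ.point m).2 = (φ.point n).2 →
      accTime h (φ.point m).1 - accTime h (φ.point n).1 ≤ T →
      ‖φ.toFun (φ.point m).1 (φ.point m).2 - φ.toFun (φ.point n).1 (φ.point n).2 -
        ∑ i ∈ Finset.Ico n m, (accTime h (φ.point (i + 1)).1 - accTime h (φ.point i).1) •
          f (φ.point i).1‖ ≤ ε := by
  rcases tendsto_atTop_or_eventually_eq hφ.point_fst_mono with hk | ⟨c, hk⟩
  · filter_upwards [hk.eventually ((hc (hφ.isCompleteK hk)).eventually_le hh T hε)]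
      with n hn m hnm hj hT
    rcases eq_or_lt_of_le hnm with rfl | hlt
    · simpa using hε.le
    have hsn := (hφ.point_spec n).2
    have hsm := (hφ.point_spec m).2
    convert hn (φ.point m).1 (by omega) hT using 2
    rw [← Finset.sum_Ico_sub (fun i => φ.toFun (φ.point i).1 (φ.point i).2) hnm,
      ← Finset.sum_sub_distrib, Finset.sum_Ico_eq_sum_range, Finset.sum_Ico_eq_sum_range]
    have hlen : (φ.point m).1 - (φ.point n).1 = m - n := by omega
    rw [hlen]
    refine Finset.sum_congr rfl fun i hi => ?_
    rw [Finset.mem_range] at hi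
    have hj1 : (φ.point (n + i)).2 = (φ.point n).2 := le_antisymm
      ((hφ.point_snd_mono (show n + i ≤ m by omega)).trans hj.le)
      (hφ.point_snd_mono (show n ≤ n + i by omega))
    have hj2 : (φ.point (n + i + 1)).2 = (φ.point n).2 := le_antisymm
      ((hφ.point_snd_mono (show n + i + 1 ≤ m by omega)).trans hj.le)
      (hφ.point_snd_mono (show n ≤ n + i + 1 by omega))
    have hflow := hj2.trans hj1.symm
    have hk1 : (φ.point n).1 + i = (φ.point (n + i)).1 := by
      have := (hφ.point_spec (n + i)).2
      omega
    have hpos := hh.pos ((φ.point (n + i)).1 + 1) (by omega)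
    rw [hk1, diffQuot, hφ.jBar_point hflow, hφ.point_succ_of_flow hflow]
    simp only
    rw [accTime_succ, add_sub_cancel_left, smul_sub, smul_smul, mul_inv_cancel₀ hpos.ne', one_smul]
  · obtain ⟨N, hN⟩ := eventually_atTop.1 hk
    filter_upwards [eventually_ge_atTop N] with n hn m hnm hj _
    have h1 := hN n hn
    have h2 := hN m (hn.trans hnm)
    have hsn := (hφ.point_spec n).2
    have hsm := (hφ.point_spec m).2
    obtain rfl : m = n := by omega
    simpa using hε.le

/-- A bounded complete hybrid sequence as a step path, with velocities `f`. -/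
def HybridSeq.toStepPath (φ : HybridSeq E) (hφ : φ.IsComplete) (hb : φ.IsBounded) (h : ℕ → ℝ)
    (hh : Admissible h) (f : ℕ → E) (hf : ∃ R, ∀ k, ‖f k‖ ≤ R)
    (hc : φ.IsCompleteK → FlowCloseness φ h f) : StepPath E where
  time n := accTime h (φ.point n).1
  jumps n := (φ.point n).2
  pos n := φ.toFun (φ.point n).1 (φ.point n).2
  vel n := f (φ.point n).1
  step n := by
    rcases hφ.point_succ n with h' | h' <;> rw [h']
    · refine Or.inl ⟨rfl, ?_⟩
      simp only
      rw [accTime_succ]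
      linarith [hh.pos ((φ.point n).1 + 1) (by omega)]
    · exact Or.inr ⟨rfl, rfl⟩
  tendsto_step := by
    rcases tendsto_atTop_or_eventually_eq hφ.point_fst_mono with hk | ⟨c, hk⟩
    · have h0 : Tendsto (fun n => h ((φ.point n).1 + 1)) atTop (𝓝 0) :=
        hh.tendsto_zero.comp ((tendsto_add_atTop_nat 1).comp hk)
      have hpos : ∀ n, 0 ≤ h ((φ.point n).1 + 1) := fun n => (hh.pos _ (by omega)).le
      refine squeeze_zero (fun n => ?_) (fun n => ?_) h0
      · rcases hφ.point_succ n with h' | h' <;> rw [h'] <;> simp only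
        · rw [accTime_succ, add_sub_cancel_left]
          exact hpos n
        · rw [sub_self]
      · rcases hφ.point_succ n with h' | h' <;> rw [h'] <;> simp only
        · rw [accTime_succ, add_sub_cancel_left]
        · rw [sub_self]
          exact hpos n
    · refine tendsto_const_nhds.congr' ?_
      filter_upwards [hk, (tendsto_add_atTop_nat 1).eventually hk] with n h1 h2
      rw [h1, h2, sub_self]
  tendsto_total := by
    have h0 : ∀ k, 0 ≤ accTime h k := fun k =>
      Finset.sum_nonneg fun i _ => (hh.pos (i + 1) (by omega)).le
    rcases tendsto_atTop_or_eventually_eq hφ.point_fst_mono with hk | ⟨c, hk⟩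
    · exact (hh.tendsto_accTime.comp hk).atTop_add_nonneg fun n => Nat.cast_nonneg _
    -- Once `k` is frozen at `c`, every step is a jump and the jump count is `n - c`.
    · refine tendsto_atTop_mono' _ ?_
        ((tendsto_natCast_atTop_atTop (R := ℝ)).comp (tendsto_sub_atTop_nat c))
      filter_upwards [hk] with n hn
      have : (φ.point n).2 = n - c := by
        have := (hφ.point_spec n).2
        omega
      rw [this]
      exact le_add_of_nonneg_left (h0 _)
  bounded_pos := hφ.exists_norm_le hb
  bounded_vel := hf.imp fun R hR n => hR _
  closeness T _ hε := hφ.closeness hh hc T hε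

end ToStepPath

/-! ### Two-timescale simulations -/

theorem HybridSeq.IsBounded.map_fst {X Y : Type*} [NormedAddCommGroup X]
    [NormedAddCommGroup Y] {Φ : HybridSeq (X × Y)} (h : Φ.IsBounded) :
    (Φ.map Prod.fst).IsBounded := by
  obtain ⟨R, hR⟩ := isBounded_iff_forall_norm_le.1 h
  refine isBounded_iff_forall_norm_le.2 ⟨R, ?_⟩
  rintro _ ⟨p, hp, rfl⟩
  exact (norm_fst_le _).trans (hR _ ⟨p, hp, rfl⟩)

theorem HybridSeq.fst_mem_omegaLimit {X Y : Type*} [TopologicalSpace X] [TopologicalSpace Y]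
    {Φ : HybridSeq (X × Y)} (hφ : Φ.IsComplete) {z : X × Y} (hz : z ∈ Φ.omegaLimit) : z.1 ∈ (Φ.map Prod.fst).omegaLimit := by
  have hφ' : (Φ.map Prod.fst).IsComplete := hφ
  rw [hφ.omegaLimit_eq] at hz
  rw [hφ'.omegaLimit_eq]
  obtain ⟨U, hU, hz⟩ := mapClusterPt_iff_ultrafilter.1 hz
  exact mapClusterPt_iff_ultrafilter.2 ⟨U, hU, hz.fst_nhds⟩

section TwoTimescale

variable {X Y : Type*} [NormedAddCommGroup X] [NormedSpace ℝ X]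
  [NormedAddCommGroup Y] [NormedSpace ℝ Y] [ProperSpace Y]

/-- The slow component of a two-timescale simulation is a step path that simulates the reduced
system. -/
theorem TwoTimescaleSystem.IsTwoTimescaleSimulation.exists_stepPath
    {S : TwoTimescaleSystem X Y} {Φ : HybridSeq (X × Y)} {hs hf : ℕ → ℝ}
    (hΦ : S.IsTwoTimescaleSimulation Φ hs hf) {Λ : X → Set Y} (hω : Φ.omegaLimit ⊆ graph Λ) :
    ∃ P : StepPath X, P.omega = (Φ.map Prod.fst).omegaLimit ∧
      P.Simulates (S.reduced Λ) fun x => {v | ∃ y ∈ restrictGraph Λ S.C x, v ∈ S.Fs (x, y)} := by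
  have hφ : Φ.IsComplete := hΦ.isComplete
  obtain ⟨f, hfb, hfc⟩ : ∃ f : ℕ → X × Y, Bornology.IsBounded (range f) ∧ (Φ.IsCompleteK →
      outerLimit (fun k => (Φ.toFun k (Φ.jBar k), f k)) ⊆ graph (restrictTo S.unit.F S.unit.C) ∧
      FlowCloseness (Φ.map Prod.fst) hs (fun k => (f k).1)) := by
    by_cases hK : Φ.IsCompleteK
    · obtain ⟨f, h1, h2, h3, -⟩ := hΦ.flow hK
      exact ⟨f, h1, fun _ => ⟨h2, h3⟩⟩
    -- Without completeness in `k` flow steps eventually stop, so zero serves as a dummy velocity.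
    · exact ⟨fun _ => 0, Bornology.isBounded_singleton.subset range_const_subset,
        fun h => absurd h hK⟩
  obtain ⟨Rf, hRf⟩ := isBounded_iff_forall_norm_le.1 hfb
  replace hRf : ∀ k, ‖f k‖ ≤ Rf := fun k => hRf _ (mem_range_self k)
  obtain ⟨R, hR⟩ := hφ.exists_norm_le hΦ.isBounded
  have hmem : ∀ (U : Ultrafilter ℕ) (z : X × Y), ↑U ≤ (atTop : Filter ℕ) →
      Tendsto (fun n => Φ.toFun (Φ.point n).1 (Φ.point n).2) U (𝓝 z) → z.2 ∈ Λ z.1 := by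
    intro U z hU hz
    refine hω ?_
    rw [hφ.omegaLimit_eq]
    exact mapClusterPt_iff_ultrafilter.2 ⟨U, hU, hz⟩
  have hφ' : (Φ.map Prod.fst).IsComplete := hφ
  refine ⟨(Φ.map Prod.fst).toStepPath hφ' hΦ.isBounded.map_fst hs hΦ.admissible.slow
    (fun k => (f k).1) ⟨Rf, fun k => (norm_fst_le _).trans (hRf k)⟩ fun hK => (hfc hK).2,
    hφ'.omegaLimit_eq.symm, fun x => Subset.rfl, ?_, ?_⟩
  · intro U x v hU hj hx hv
    replace hj : ∀ᶠ n in U, (Φ.point (n + 1)).2 = (Φ.point n).2 := hj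
    replace hx : Tendsto (fun n => (Φ.toFun (Φ.point n).1 (Φ.point n).2).1) U (𝓝 x) := hx
    replace hv : Tendsto (fun n => (f (Φ.point n).1).1) U (𝓝 v) := hv
    -- Flow steps occur arbitrarily late along `U`, so `k` cannot become constant and the flow
    -- condition is available.
    have hk : Tendsto (fun n => (Φ.point n).1) atTop atTop := by
      refine (tendsto_atTop_or_eventually_eq hφ.point_fst_mono).resolve_right ?_
      rintro ⟨c, hc⟩
      obtain ⟨n, h1, h2, h3⟩ := (hj.and ((hc.filter_mono hU).and
        (((tendsto_add_atTop_nat 1).eventually hc).filter_mono hU))).exists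
      have := congrArg Prod.fst (hφ.point_succ_of_flow h1)
      simp only at this
      omega
    obtain ⟨y, hy⟩ := exists_tendsto_of_norm_le U fun n => (norm_snd_le _).trans (hR n)
    -- A limit of the fast velocity completes the accumulation point in the product space; its value
    -- plays no further role.
    obtain ⟨w, hw⟩ := exists_tendsto_of_norm_le U fun n =>
      (norm_snd_le _).trans (hRf (Φ.point n).1)
    have hlim : ((x, y), (v, w)) ∈ outerLimit fun k => (Φ.toFun k (Φ.jBar k), f k) := by
      refine mapClusterPt_iff_ultrafilter.2 ⟨U.map fun n => (Φ.point n).1, hk.mono_left hU, ?_⟩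
      refine ((hx.prodMk_nhds hy).prodMk_nhds (hv.prodMk_nhds hw)).congr' ?_
      filter_upwards [hj] with n hn
      simp only [hφ.jBar_point hn]
    have hg := (hfc (hφ.isCompleteK hk)).1 hlim
    have hyΛ : y ∈ restrictGraph Λ S.C x := ⟨hmem U (x, y) hU (hx.prodMk_nhds hy), hg.1⟩
    exact ⟨⟨y, hyΛ⟩, y, hyΛ, hg.2.1⟩
  · intro U x x' hU hj hx hx'
    replace hj : ∀ᶠ n in U, (Φ.point (n + 1)).2 = (Φ.point n).2 + 1 := hj
    replace hx : Tendsto (fun n => (Φ.toFun (Φ.point n).1 (Φ.point n).2).1) U (𝓝 x) := hx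
    replace hx' : Tendsto (fun n => (Φ.toFun (Φ.point (n + 1)).1 (Φ.point (n + 1)).2).1) U
      (𝓝 x') := hx'
    have hk : Tendsto (fun n => (Φ.point n).2) atTop atTop := by
      refine (tendsto_atTop_or_eventually_eq hφ.point_snd_mono).resolve_right ?_
      rintro ⟨c, hc⟩
      obtain ⟨n, h1, h2, h3⟩ := (hj.and ((hc.filter_mono hU).and
        (((tendsto_add_atTop_nat 1).eventually hc).filter_mono hU))).exists
      omega
    obtain ⟨y, hy⟩ := exists_tendsto_of_norm_le U fun n => (norm_snd_le _).trans (hR n)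
    obtain ⟨y', hy'⟩ := exists_tendsto_of_norm_le U fun n => (norm_snd_le _).trans (hR (n + 1))
    have hlim : ((x, y), (x', y')) ∈
        outerLimit fun j => (Φ.toFun (Φ.kBar j) j, Φ.toFun (Φ.kBar j) (j + 1)) := by
      refine mapClusterPt_iff_ultrafilter.2 ⟨U.map fun n => (Φ.point n).2, hk.mono_left hU, ?_⟩
      refine ((hx.prodMk_nhds hy).prodMk_nhds (hx'.prodMk_nhds hy')).congr' ?_
      filter_upwards [hj] with n hn
      simp only [hφ.kBar_point hn, hφ.point_succ_of_jump hn]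
    have hg := hΦ.jump (hφ.isCompleteJ hk) hlim
    have hyΛ : y ∈ restrictGraph Λ S.D x := ⟨hmem U (x, y) hU (hx.prodMk_nhds hy), hg.1⟩
    exact ⟨⟨y, hyΛ⟩, y, hyΛ, (x', y'), hg.2, rfl⟩

end TwoTimescale

/-- Solutions start in the flow or jump set, hence so do the points of a chain transitive set. -/
theorem HybridSystem.InternallyChainTransitive.subset {E : Type*} [NormedAddCommGroup E]
    [NormedSpace ℝ E] {H : HybridSystem E} {A : Set E} (hA : H.InternallyChainTransitive A) :
    A ⊆ H.C ∪ H.D := by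
  intro a ha
  obtain ⟨n, x, ψ, q, hn, h0, -, hlink⟩ := hA a ha a ha 1 1 one_pos one_pos
  obtain ⟨hψ, hψ0, -⟩ := hlink 0 hn
  rw [← h0, ← hψ0]
  exact hψ.initial

/-- Supplies the compact set that contains every chain transitive set: the projection of the graph
of `Λ`. -/
theorem TwoTimescaleSystem.reduced_subset {X Y : Type*} [NormedAddCommGroup X] [NormedSpace ℝ X]
    (S : TwoTimescaleSystem X Y) (Λ : X → Set Y) :
    (S.reduced Λ).C ∪ (S.reduced Λ).D ⊆ Prod.fst '' graph Λ := by
  rintro x (⟨y, hy⟩ | ⟨y, hy⟩) <;> exact ⟨(x, y), hy.1, rfl⟩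

end HybridInclusion

end

/-! ### Conclusion for two-timescale simulations -/

theorem mainTheorem3 {ns nf : ℕ}
    (S : HybridInclusion.TwoTimescaleSystem
      (EuclideanSpace ℝ (Fin ns)) (EuclideanSpace ℝ (Fin nf)))
    (hS : S.unit.BasicConditions)
    (Φ : HybridInclusion.HybridSeq (EuclideanSpace ℝ (Fin ns) × EuclideanSpace ℝ (Fin nf)))
    (hs hf : ℕ → ℝ) (hΦ : S.IsTwoTimescaleSimulation Φ hs hf)
    (Λ : EuclideanSpace ℝ (Fin ns) → Set (EuclideanSpace ℝ (Fin nf)))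
    (hΛ : IsCompact (HybridInclusion.graph Λ))
    (hωΛ : Φ.omegaLimit ⊆ HybridInclusion.graph Λ) :
    (∃ K : Set (EuclideanSpace ℝ (Fin ns)), IsCompact K ∧
      ∀ A, (S.reduced Λ).WeaklyInvariant A → (S.reduced Λ).InternallyChainTransitive A → A ⊆ K) ∧
    (∀ K : Set (EuclideanSpace ℝ (Fin ns)), IsCompact K →
      (∀ A, (S.reduced Λ).WeaklyInvariant A → (S.reduced Λ).InternallyChainTransitive A →
        A ⊆ K) →
      Φ.omegaLimit ⊆ HybridInclusion.graph Λ ∩ K ×ˢ Set.univ) ∧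
    (Φ.map Prod.fst).omegaLimit.Nonempty ∧
    IsCompact (Φ.map Prod.fst).omegaLimit ∧
    (S.reduced Λ).InternallyChainTransitive (Φ.map Prod.fst).omegaLimit ∧
    (S.reduced Λ).WeaklyInvariant (Φ.map Prod.fst).omegaLimit := by
  obtain ⟨P, hPω, hP⟩ := hΦ.exists_stepPath hωΛ
  have hinv := hP.weaklyInvariant_omega
  have hict := hP.internallyChainTransitive_omega
  rw [hPω] at hinv hict
  refine ⟨⟨Prod.fst '' HybridInclusion.graph Λ, hΛ.image continuous_fst,
    fun A _ hA => hA.subset.trans (S.reduced_subset Λ)⟩, fun K _ hK z hz =>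
    ⟨hωΛ hz, hK _ hinv hict (HybridInclusion.HybridSeq.fst_mem_omegaLimit hΦ.isComplete hz),
      Set.mem_univ _⟩, hPω ▸ HybridInclusion.StepPath.omega_nonempty, hinv.1, hict, hinv⟩
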